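/- Let $SL(2,\mathbb R)\times SL(2,\mathbb R)$ carry its nearly Kähler structure: on tangent vectors $(A\alpha,B\beta)$ at $(A,B)$ ($\alpha,\beta$ of trace $0$) put $$J(A\alpha,B\beta)=\tfrac1{\sqrt3}\bigl(A(\alpha-2\beta),B(2\alpha-\beta)\bigr),\qquad P(A\alpha,B\beta)=(A\beta,B\alpha),\qquad g(Z,Z')=\tfrac23\langle Z,Z'\rangle-\tfrac13\langle PZ,Z'\rangle ,$$ where $\langle (U,V),(U',V')\rangle=\langle U,U'\rangle+\langle V,V'\rangle$ and $\langle a,b\rangle=-\tfrac12(a_1b_4-a_2b_3-a_3b_2+a_4b_1)$ for real $2\times2$ matrices $a=\begin{pmatrix}a_1&a_2\\a_3&a_4\end{pmatrix}$, $b=\begin{pmatrix}b_1&b_2\\b_3&b_4\end{pmatrix}$. Let $M$ be a connected smooth surface and $F:M\to SL(2,\mathbb R)\times SL(2,\mathbb R)$ a smooth immersion such that the induced metric $F^*g$ is nondegenerate, $J$ maps each tangent plane of $M$ into itself (i.e. $M$ is an almost complex surface), $M$ is totally geodesic with respect to the Levi-Civita connection of $g$, and $P$ maps tangent vectors of $M$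 to normal vectors. Then $M$ is congruent to the immersion $(A,B)$ of the hyperbolic quadric $y_1^2+y_2^2-y_3^2=-1$ given by $$A(y)=\begin{pmatrix}\frac{\sqrt3}{2}y_1+\frac12&\frac{\sqrt3}{2}(y_2+y_3)\\ \frac{\sqrt3}{2}(y_2-y_3)&\frac12-\frac{\sqrt3}{2}y_1\end{pmatrix},\qquad B(y)=\begin{pmatrix}\frac12-\frac{\sqrt3}{2}y_1&-\frac{\sqrt3}{2}(y_2+y_3)\\ -\frac{\sqrt3}{2}(y_2-y_3)&\frac{\sqrt3}{2}y_1+\frac12\end{pmatrix},$$ that is, there are $a,b,c\in SL(2,\mathbb R)$, giving the isometry $(p,q)\mapsto(apc,bqc)$ of $g$, and a smooth immersion $y=(y_1,y_2,y_3)$ of $M$ into this quadric, such that $F(p)=\bigl(a\,A(y(p))\,c,\;b\,B(y(p))\,c\bigr)$ for all $p\in M$. Moreover the induced metric on $M$ has constant Gaussian curvature $K=-\tfrac43$. -/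

import Mathlib

open scoped Manifold ContDiff

namespace NKSL

/-! ## The nearly Kaehler structure of `SL(2,ℝ) × SL(2,ℝ)` -/

/-- Real `2 × 2` matrices. -/
abbrev Mat2 : Type := Matrix (Fin 2) (Fin 2) ℝ

/-- The group `SL(2,ℝ)`. -/
abbrev SL2 : Type := Matrix.SpecialLinearGroup (Fin 2) ℝ

/-- The ambient space `SL(2,ℝ) × SL(2,ℝ)`. -/
abbrev Amb : Type := SL2 × SL2

/-- The indefinite inner product
`⟨a, b⟩ = -1/2 (a₁ b₄ - a₂ b₃ - a₃ b₂ + a₄ b₁)` on `M(2,ℝ) = ℝ⁴`. -/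
noncomputable def ip (X Y : Mat2) : ℝ :=
  -(1 / 2) * (X 0 0 * Y 1 1 - X 0 1 * Y 1 0 - X 1 0 * Y 0 1 + X 1 1 * Y 0 0)

/-- Left translation to `x = (A, B)`: it sends `(α, β)` to `(Aα, Bβ)`. -/
def push (x : Amb) (a : Mat2 × Mat2) : Mat2 × Mat2 :=
  ((x.1 : Mat2) * a.1, (x.2 : Mat2) * a.2)

/-- The left trivialisation at `x = (A, B)`: it sends `Z = (Aα, Bβ)` to `(α, β)`. -/
def pull (x : Amb) (Z : Mat2 × Mat2) : Mat2 × Mat2 :=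
  (((x.1⁻¹ : SL2) : Mat2) * Z.1, ((x.2⁻¹ : SL2) : Mat2) * Z.2)

/-- The tangent space of `SL(2,ℝ) × SL(2,ℝ)` at `x = (A, B)`, i.e. all `(Aα, Bβ)` with
`α, β` of trace zero. -/
def IsTangentAt (x : Amb) (Z : Mat2 × Mat2) : Prop :=
  (pull x Z).1.trace = 0 ∧ (pull x Z).2.trace = 0

/-- The almost complex structure
`J (Aα, Bβ) = (1/√3) (A(α - 2β), B(2α - β))`. -/
noncomputable def J (x : Amb) (Z : Mat2 × Mat2) : Mat2 × Mat2 :=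
  let a := pull x Z
  push x ((1 / √3 : ℝ) • (a.1 - (2 : ℝ) • a.2), (1 / √3 : ℝ) • ((2 : ℝ) • a.1 - a.2))

/-- The almost product structure `P (Aα, Bβ) = (Aβ, Bα)`. -/
def P (x : Amb) (Z : Mat2 × Mat2) : Mat2 × Mat2 :=
  push x ((pull x Z).2, (pull x Z).1)

/-- The usual product metric `⟨(U, V), (U', V')⟩ = ⟨U, U'⟩ + ⟨V, V'⟩`. -/
noncomputable def prodMetric (Z W : Mat2 × Mat2) : ℝ := ip Z.1 W.1 + ip Z.2 W.2

/-- The nearly Kaehler metric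
`g (Z, W) = 2/3 ⟨Z, W⟩ - 1/3 ⟨P Z, W⟩` at the point `x`. -/
noncomputable def g (x : Amb) (Z W : Mat2 × Mat2) : ℝ :=
  2 / 3 * prodMetric Z W - 1 / 3 * prodMetric (P x Z) W

/-- `α × β = 1/2 (αβ - βα)`. -/
noncomputable def cross (a b : Mat2) : Mat2 := (1 / 2 : ℝ) • (a * b - b * a)

/-- The Levi-Civita connection of `g` on left invariant vector fields: for the left invariant
fields `X = (Aα, Bβ)` and `Y = (Aγ, Bδ)` with `a = (α, β)`, `b = (γ, δ)` constant, the field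
`∇_X Y` is the left invariant field of `leviCivita a b`. It is the one and only bilinear
operation which is torsion free and compatible with `g`, see `leviCivita_torsion`,
`leviCivita_metric` and `leviCivita_unique`. -/
noncomputable def leviCivita (a b : Mat2 × Mat2) : Mat2 × Mat2 :=
  (cross a.1 b.1 - (1 / 3 : ℝ) • cross a.1 b.2 + (1 / 3 : ℝ) • cross a.2 b.1,
   cross a.2 b.2 + (1 / 3 : ℝ) • cross a.1 b.2 - (1 / 3 : ℝ) • cross a.2 b.1)

/-- The connection is torsion free: `∇_X Y - ∇_Y X = [X, Y]`. -/
theorem leviCivita_torsion (a b : Mat2 × Mat2) :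
    leviCivita a b - leviCivita b a = (a.1 * b.1 - b.1 * a.1, a.2 * b.2 - b.2 * a.2) := by
  ext i j <;> fin_cases i <;> fin_cases j <;>
    simp [leviCivita, cross, Matrix.mul_apply, Fin.sum_univ_two] <;> ring

/-- The metric at a general point is left invariant. -/
theorem g_push (x : Amb) (a b : Mat2 × Mat2) : g x (push x a) (push x b) = g 1 a b := by
  obtain ⟨A, B⟩ := x
  have hip : ∀ (A : SL2) (X Y : Mat2), ip ((A : Mat2) * X) ((A : Mat2) * Y) = ip X Y := by
    intro A X Y
    have h := A.det_coe
    rw [Matrix.det_fin_two] at h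
    simp only [ip, Matrix.mul_apply, Fin.sum_univ_two]
    linear_combination
      (-(1 / 2) * (X 0 0 * Y 1 1 - X 0 1 * Y 1 0 - X 1 0 * Y 0 1 + X 1 1 * Y 0 0)) * h
  have hc : ∀ (A : SL2) (X : Mat2), ((A⁻¹ : SL2) : Mat2) * ((A : Mat2) * X) = X := by
    intro A X
    rw [← Matrix.mul_assoc, ← Matrix.SpecialLinearGroup.coe_mul, inv_mul_cancel,
      Matrix.SpecialLinearGroup.coe_one, Matrix.one_mul]
  simp only [g, prodMetric, P, push, pull, hip, hc, Prod.fst_one, Prod.snd_one, inv_one,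
    Matrix.SpecialLinearGroup.coe_one,
    Matrix.one_mul]

/-- The connection is metric: `g (∇_X Y, Z) + g (Y, ∇_X Z) = 0` for left invariant fields
(whose inner products are constant). -/
theorem leviCivita_metric (a b c : Mat2 × Mat2) :
    g 1 (leviCivita a b) c + g 1 b (leviCivita a c) = 0 := by
  simp [g, prodMetric, P, push, pull, ip, leviCivita, cross, Matrix.mul_apply,
    Fin.sum_univ_two]
  ring

/-- The metric `g` is nondegenerate on tangent vectors. -/
theorem g_nondegenerate (a : Mat2 × Mat2) (ha : IsTangentAt 1 a)
    (h : ∀ b, IsTangentAt 1 b → g 1 a b = 0) : a = 0 := by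
  obtain ⟨h1, h2⟩ := ha
  have e1 := h (!![1, 0; 0, -1], 0) (by simp [IsTangentAt, pull, Matrix.trace_fin_two])
  have e2 := h (!![0, 1; 0, 0], 0) (by simp [IsTangentAt, pull, Matrix.trace_fin_two])
  have e3 := h (!![0, 0; 1, 0], 0) (by simp [IsTangentAt, pull, Matrix.trace_fin_two])
  have e4 := h (0, !![1, 0; 0, -1]) (by simp [IsTangentAt, pull, Matrix.trace_fin_two])
  have e5 := h (0, !![0, 1; 0, 0]) (by simp [IsTangentAt, pull, Matrix.trace_fin_two])
  have e6 := h (0, !![0, 0; 1, 0]) (by simp [IsTangentAt, pull, Matrix.trace_fin_two])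
  simp [pull, Matrix.trace_fin_two] at h1 h2
  simp [g, prodMetric, P, push, pull, ip] at e1 e2 e3 e4 e5 e6
  ext i j <;> fin_cases i <;> fin_cases j <;> simp <;> linarith

/-- Uniqueness: an operation on pairs of trace zero matrices which is compatible with the metric
and torsion free is `leviCivita`. -/
theorem leviCivita_unique (D : Mat2 × Mat2 → Mat2 × Mat2 → Mat2 × Mat2)
    (htan : ∀ a b, IsTangentAt 1 a → IsTangentAt 1 b → IsTangentAt 1 (D a b))
    (htor : ∀ a b, IsTangentAt 1 a → IsTangentAt 1 b →
      D a b - D b a = (a.1 * b.1 - b.1 * a.1, a.2 * b.2 - b.2 * a.2))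
    (hmet : ∀ a b c, IsTangentAt 1 a → IsTangentAt 1 b → IsTangentAt 1 c →
      g 1 (D a b) c + g 1 b (D a c) = 0)
    (a b : Mat2 × Mat2) (ha : IsTangentAt 1 a) (hb : IsTangentAt 1 b) :
    D a b = leviCivita a b := by
  have gsub : ∀ u v w, g 1 (u - v) w = g 1 u w - g 1 v w := by
    intro u v w; simp [g, prodMetric, P, push, pull, ip]; ring
  have gsymm : ∀ u v, g 1 u v = g 1 v u := by
    intro u v; simp [g, prodMetric, P, push, pull, ip]; ring
  have tsub : ∀ u v, IsTangentAt 1 u → IsTangentAt 1 v → IsTangentAt 1 (u - v) := by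
    intro u v hu hv
    simp only [IsTangentAt, pull, Matrix.trace_fin_two] at *
    simp at *
    constructor <;> linarith [hu.1, hu.2, hv.1, hv.2]
  have tLC : ∀ u v, IsTangentAt 1 (leviCivita u v) := by
    intro u v
    constructor <;>
      simp [leviCivita, cross, pull, Matrix.trace_fin_two, Matrix.mul_apply,
        Fin.sum_univ_two] <;> ring
  -- the difference tensor
  set S : Mat2 × Mat2 → Mat2 × Mat2 → Mat2 × Mat2 := fun u v => D u v - leviCivita u v with hS
  have Ssymm : ∀ u v, IsTangentAt 1 u → IsTangentAt 1 v → S u v = S v u := by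
    intro u v hu hv
    have h1 := htor u v hu hv
    have h2 := leviCivita_torsion u v
    have h3 : D u v - D v u = leviCivita u v - leviCivita v u := h1.trans h2.symm
    simp only [hS]
    rw [sub_eq_sub_iff_add_eq_add] at h3 ⊢
    rw [h3, add_comm]
  have Sskew : ∀ u v w, IsTangentAt 1 u → IsTangentAt 1 v → IsTangentAt 1 w →
      g 1 (S u v) w = - g 1 (S u w) v := by
    intro u v w hu hv hw
    have h1 := hmet u v w hu hv hw
    have h2 := leviCivita_metric u v w
    have h3 := gsymm v (D u w)
    have h4 := gsymm v (leviCivita u w)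
    simp only [hS, gsub]
    linarith
  have key : S a b = 0 := by
    apply g_nondegenerate _ (tsub _ _ (htan a b ha hb) (tLC a b))
    intro c hc
    change g 1 (S a b) c = 0
    have k1 := Sskew a b c ha hb hc
    have k2 := Sskew c a b hc ha hb
    have k3 := Sskew b c a hb hc ha
    rw [Ssymm c a hc ha, Ssymm c b hc hb] at k2
    rw [Ssymm b a hb ha] at k3
    linarith
  exact sub_eq_zero.mp key

/-- The maps `(p, q) ↦ (a p c, b q c)` of `SL(2,ℝ) × SL(2,ℝ)`, `a, b, c ∈ SL(2,ℝ)`. -/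
def congruence (a b c : SL2) (x : Amb) : Amb := (a * x.1 * c, b * x.2 * c)

/-- The differential of `congruence a b c`: it is the restriction of a linear map. -/
def congruenceDiff (a b c : SL2) (Z : Mat2 × Mat2) : Mat2 × Mat2 :=
  ((a : Mat2) * Z.1 * (c : Mat2), (b : Mat2) * Z.2 * (c : Mat2))

/-- The maps `congruence a b c` are isometries of the metric `g`. -/
theorem congruence_isometry (a b c : SL2) (x : Amb) (Z W : Mat2 × Mat2) :
    g (congruence a b c x) (congruenceDiff a b c Z) (congruenceDiff a b c W) = g x Z W := by
  obtain ⟨A, B⟩ := x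
  have hl : ∀ (A : SL2) (X Y : Mat2), ip ((A : Mat2) * X) ((A : Mat2) * Y) = ip X Y := by
    intro A X Y
    have h := A.det_coe
    rw [Matrix.det_fin_two] at h
    simp only [ip, Matrix.mul_apply, Fin.sum_univ_two]
    linear_combination
      (-(1 / 2) * (X 0 0 * Y 1 1 - X 0 1 * Y 1 0 - X 1 0 * Y 0 1 + X 1 1 * Y 0 0)) * h
  have hr : ∀ (A : SL2) (X Y : Mat2), ip (X * (A : Mat2)) (Y * (A : Mat2)) = ip X Y := by
    intro A X Y
    have h := A.det_coe
    rw [Matrix.det_fin_two] at h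
    simp only [ip, Matrix.mul_apply, Fin.sum_univ_two]
    linear_combination
      (-(1 / 2) * (X 0 0 * Y 1 1 - X 0 1 * Y 1 0 - X 1 0 * Y 0 1 + X 1 1 * Y 0 0)) * h
  have hc : ∀ (A b B : SL2) (V : Mat2), ((A * c : SL2) : Mat2) *
      (((b * B * c)⁻¹ : SL2) : Mat2) * ((b : Mat2) * V * (c : Mat2)) =
      (A : Mat2) * (((B⁻¹ : SL2) : Mat2) * V) * (c : Mat2) := by
    intro A b B V
    have h1 : (A * c) * (b * B * c)⁻¹ * b = A * B⁻¹ := by group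
    have h2 := congrArg (fun s : SL2 => (s : Mat2)) h1
    simp only [Matrix.SpecialLinearGroup.coe_mul] at h2 ⊢
    simp only [← Matrix.mul_assoc] at h2 ⊢
    rw [h2]
  have e1 : P (congruence a b c (A, B)) (congruenceDiff a b c Z)
      = congruenceDiff a b c (P (A, B) Z) := by
    have k1 := hc (a * A) b B Z.2
    have k2 := hc (b * B) a A Z.1
    simp only [Matrix.SpecialLinearGroup.coe_mul, Matrix.mul_assoc] at k1 k2
    simp only [P, push, pull, congruence, congruenceDiff, Matrix.SpecialLinearGroup.coe_mul,
      Matrix.mul_assoc]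
    rw [k1, k2]
  rw [g, e1]
  simp only [g, prodMetric, congruenceDiff, hr, hl]

/-! ## Surfaces in `SL(2,ℝ) × SL(2,ℝ)` -/

section Surface

variable {M : Type*} [TopologicalSpace M] [ChartedSpace (EuclideanSpace ℝ (Fin 2)) M]

/-- A map into `SL(2,ℝ) × SL(2,ℝ)`, an embedded submanifold of `M(2,ℝ) × M(2,ℝ)`, is smooth when
all the matrix entries are smooth. -/
def IsSmooth (F : M → Amb) : Prop :=
  ∀ i j : Fin 2,
    ContMDiff (𝓡 2) 𝓘(ℝ, ℝ) ∞ (fun q => ((F q).1 : Mat2) i j) ∧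
    ContMDiff (𝓡 2) 𝓘(ℝ, ℝ) ∞ (fun q => ((F q).2 : Mat2) i j)

/-- The derivative at `p`, in direction `v`, of a function with values in
`M(2,ℝ) × M(2,ℝ)`, entry by entry. -/
noncomputable def deriv2 (f : M → Mat2 × Mat2) (p : M) (v : TangentSpace (𝓡 2) p) :
    Mat2 × Mat2 :=
  (Matrix.of fun i j => mfderiv (𝓡 2) 𝓘(ℝ, ℝ) (fun q => (f q).1 i j) p v,
   Matrix.of fun i j => mfderiv (𝓡 2) 𝓘(ℝ, ℝ) (fun q => (f q).2 i j) p v)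

/-- The differential `dF_p (v)`. -/
noncomputable def differential (F : M → Amb) (p : M) (v : TangentSpace (𝓡 2) p) :
    Mat2 × Mat2 :=
  deriv2 (fun q => (((F q).1 : Mat2), ((F q).2 : Mat2))) p v

/-- The metric induced by `g` on `M`. -/
noncomputable def inducedMetric (F : M → Amb) (p : M) (v w : TangentSpace (𝓡 2) p) : ℝ :=
  g (F p) (differential F p v) (differential F p w)

/-- An almost complex surface: a smooth immersion whose tangent planes are invariant under `J`,
regular in the sense that the induced metric is nondegenerate. -/
structure IsAlmostComplexSurface (F : M → Amb) : Prop where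
  smooth : IsSmooth F
  immersion : ∀ p, Function.Injective (differential F p)
  complex : ∀ p (v : TangentSpace (𝓡 2) p),
    ∃ w : TangentSpace (𝓡 2) p, differential F p w = J (F p) (differential F p v)
  regular : ∀ p (v : TangentSpace (𝓡 2) p),
    (∀ w : TangentSpace (𝓡 2) p, inducedMetric F p v w = 0) → v = 0

/-- The covariant derivative at `p`, in direction `v`, of a vector field `ξ` along `F` with
respect to the Levi-Civita connection of `g`. In the left invariant frame `ξ = (Aα, Bβ)` with
functions `α, β` on `M`, the Leibniz rule gives the derivative of the coefficients plus the
connection of the left invariant fields. -/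
noncomputable def covDeriv (F : M → Amb) (ξ : M → Mat2 × Mat2) (p : M)
    (v : TangentSpace (𝓡 2) p) : Mat2 × Mat2 :=
  push (F p) (deriv2 (fun q => pull (F q) (ξ q)) p v +
    leviCivita (pull (F p) (differential F p v)) (pull (F p) (ξ p)))

/-- `M` is totally geodesic (the second fundamental form vanishes): for all vector fields `Y` of
`M` that are smooth at `p` and all tangent vectors `v` of `M` at `p`, the ambient covariant
derivative `∇_v Y` is tangent to `M`. -/
def IsTotallyGeodesic [IsManifold (𝓡 2) ∞ M] (F : M → Amb) : Prop :=
  ∀ (p : M) (Y : (q : M) → TangentSpace (𝓡 2) q),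
    ContMDiffAt (𝓡 2) (𝓡 2).tangent ∞ (fun q => (⟨q, Y q⟩ : TangentBundle (𝓡 2) M)) p →
    ∀ v : TangentSpace (𝓡 2) p, ∃ w : TangentSpace (𝓡 2) p,
      covDeriv F (fun q => differential F q (Y q)) p v = differential F p w

/-- `P` maps tangent vectors of `M` to normal vectors. -/
def PMapsTangentToNormal (F : M → Amb) : Prop :=
  ∀ (p : M) (v w : TangentSpace (𝓡 2) p),
    g (F p) (P (F p) (differential F p v)) (differential F p w) = 0

end Surface

/-! ## Gaussian curvature -/

/-- The coordinate plane. -/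
abbrev Plane : Type := EuclideanSpace ℝ (Fin 2)

/-- Partial derivative of a function on the plane. -/
noncomputable def pd (i : Fin 2) (f : Plane → ℝ) (x : Plane) : ℝ :=
  fderiv ℝ f x (EuclideanSpace.single i 1)

/-- The Christoffel symbol `Γ^k_{ij}` of a metric given by its coefficient matrix. -/
noncomputable def christoffel (h : Plane → Mat2) (k i j : Fin 2) (x : Plane) : ℝ :=
  1 / 2 * ∑ l, (h x)⁻¹ k l *
    (pd i (fun z => h z j l) x + pd j (fun z => h z i l) x - pd l (fun z => h z i j) x)

/-- The component `R^l` of `R(∂_i, ∂_j) ∂_k = ∇_i ∇_j ∂_k - ∇_j ∇_i ∂_k`. -/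
noncomputable def riemann (h : Plane → Mat2) (l i j k : Fin 2) (x : Plane) : ℝ :=
  pd i (christoffel h l j k) x - pd j (christoffel h l i k) x +
    ∑ m, (christoffel h m j k x * christoffel h l i m x -
      christoffel h m i k x * christoffel h l j m x)

/-- The Gaussian curvature `g(R(∂₁, ∂₂) ∂₂, ∂₁) / det g`. -/
noncomputable def gaussCurvature (h : Plane → Mat2) (x : Plane) : ℝ :=
  (∑ l, riemann h l 0 1 1 x * h x l 0) / (h x).det

/-- The coefficient matrix of the induced metric of a parametrised surface `f(s, t)`. -/
noncomputable def coeffMatrix (f : Plane → Amb) (x : Plane) : Mat2 :=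
  Matrix.of fun i j =>
    inducedMetric f x (EuclideanSpace.single i 1) (EuclideanSpace.single j 1)

/-- The induced metric of `F` has constant Gaussian curvature `K`, computed in any smooth chart
`e` of `M`. -/
def HasGaussCurvature {M : Type*} [TopologicalSpace M] [ChartedSpace Plane M]
    (F : M → Amb) (K : ℝ) : Prop :=
  ∀ e ∈ IsManifold.maximalAtlas (𝓡 2) ∞ M, ∀ x ∈ e.target,
    gaussCurvature (coeffMatrix (fun z => F (e.symm z))) x = K

/-! ## The explicit immersion -/

/-- The quadric `y₁² + y₂² - y₃² = -1`. -/
def Quadric : Set (Fin 3 → ℝ) := {y | y 0 ^ 2 + y 1 ^ 2 - y 2 ^ 2 = -1}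

/-- The first component of the explicit immersion. -/
noncomputable def modelA (y : Fin 3 → ℝ) : Mat2 :=
  !![√3 * y 0 / 2 + 1 / 2, 1 / 2 * √3 * (y 1 + y 2);
     1 / 2 * √3 * (y 1 - y 2), 1 / 2 - √3 * y 0 / 2]

/-- The second component of the explicit immersion. -/
noncomputable def modelB (y : Fin 3 → ℝ) : Mat2 :=
  !![1 / 2 - √3 * y 0 / 2, -(1 / 2) * √3 * (y 1 + y 2);
     -(1 / 2) * √3 * (y 1 - y 2), √3 * y 0 / 2 + 1 / 2]

theorem det_modelA {y : Fin 3 → ℝ} (hy : y ∈ Quadric) : (modelA y).det = 1 := by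
  have h3 : √3 * √3 = (3 : ℝ) := Real.mul_self_sqrt (by norm_num)
  have hy' : y 0 ^ 2 + y 1 ^ 2 - y 2 ^ 2 = -1 := hy
  rw [modelA, Matrix.det_fin_two_of]
  linear_combination (-(3 / 4 : ℝ)) * hy' - (1 / 4) * (y 0 ^ 2 + y 1 ^ 2 - y 2 ^ 2) * h3

theorem det_modelB {y : Fin 3 → ℝ} (hy : y ∈ Quadric) : (modelB y).det = 1 := by
  have h3 : √3 * √3 = (3 : ℝ) := Real.mul_self_sqrt (by norm_num)
  have hy' : y 0 ^ 2 + y 1 ^ 2 - y 2 ^ 2 = -1 := hy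
  rw [modelB, Matrix.det_fin_two_of]
  linear_combination (-(3 / 4 : ℝ)) * hy' - (1 / 4) * (y 0 ^ 2 + y 1 ^ 2 - y 2 ^ 2) * h3

/-- The explicit immersion `(A, B)` of the quadric into `SL(2,ℝ) × SL(2,ℝ)`. -/
noncomputable def model (y : Quadric) : Amb :=
  (⟨modelA y, det_modelA y.2⟩, ⟨modelB y, det_modelB y.2⟩)

end NKSL

/-! Write tangent vectors as `(Aα, Bβ)`. Since `P` sends tangent vectors to normal ones and the
plane is `J`-invariant, both `PZ ⊥ Z` and `PZ ⊥ JZ` hold, and these say `⟨α,α⟩ = ⟨β,β⟩ = 2⟨α,β⟩`.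
Then `g(Z,Z) = ⟨α,α⟩ = -det α` and `Z ⊥ JZ`, so nondegeneracy makes `α` invertible for `Z ≠ 0`
(`det_leftDiff_ne_zero`). The matrix `U = βα⁻¹` has trace and determinant one, hence `U² = U - 1`
and `U⁻¹ = 1 - U`. The vector `JZ` has the same quotient `U`, so one `U(p)` satisfies `β = Uα` on
the whole tangent plane (`quotient_spec`).

Total geodesy enters once: tangency of `∇_Y Y` forces `dU = -αU` (`matDeriv_rotation`). With `αU =
(1 - U)α` this gives `d(AU) = 0` and `d(BU⁻¹) = 0`. By connectedness `A = aU⁻¹` and `B = bU` with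
constant `a`, `b`. The explicit immersion is exactly `U ↦ (U⁻¹, U)` written in coordinates `y` of
the trace-one matrices in `SL(2,ℝ)` (`model_quadricCoord`), so the congruence holds with `c = 1`.

For the curvature, `g(Z,Z') = ⟨α,α'⟩ = ⟨dU(v),dU(v')⟩`, which is `3/4` of the Lorentz product of
`dy(v)` and `dy(v')` (`inducedMetric_eq_lorentz`). This also shows that `y` is an immersion. The
quadric has curvature `-1`, proved in coordinates from the Gauss formula and the symmetry of third
derivatives (`gaussCurvature_of_quadric`); scaling by `3/4` gives `-4/3`. -/

namespace NKSL

/-! ### Calculus of matrix-valued functions on a surface -/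

section MatrixCalculus

variable {M : Type*} [TopologicalSpace M] [ChartedSpace (EuclideanSpace ℝ (Fin 2)) M]

/-- Smoothness at a point of a matrix valued function, entry by entry. -/
def SmoothMatAt (f : M → Mat2) (p : M) : Prop :=
  ∀ i j : Fin 2, ContMDiffAt (𝓡 2) 𝓘(ℝ, ℝ) ∞ (fun q => f q i j) p

/-- The derivative of a matrix valued function, entry by entry. -/
noncomputable def matDeriv (f : M → Mat2) (p : M) (v : TangentSpace (𝓡 2) p) : Mat2 :=
  Matrix.of fun i j => mfderiv (𝓡 2) 𝓘(ℝ, ℝ) (fun q => f q i j) p v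

theorem matDeriv_apply (f : M → Mat2) (p : M) (v : TangentSpace (𝓡 2) p) (i j : Fin 2) :
    matDeriv f p v i j = mfderiv (𝓡 2) 𝓘(ℝ, ℝ) (fun q => f q i j) p v := rfl

theorem deriv2_eq (f : M → Mat2 × Mat2) (p : M) (v : TangentSpace (𝓡 2) p) :
    deriv2 f p v = (matDeriv (fun q => (f q).1) p v, matDeriv (fun q => (f q).2) p v) := rfl

theorem matDeriv_add_right (f : M → Mat2) (p : M) (v w : TangentSpace (𝓡 2) p) :
    matDeriv f p (v + w) = matDeriv f p v + matDeriv f p w := by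
  ext i j
  simp only [Matrix.add_apply, matDeriv_apply]
  exact map_add _ v w

theorem matDeriv_smul_right (f : M → Mat2) (p : M) (c : ℝ) (v : TangentSpace (𝓡 2) p) :
    matDeriv f p (c • v) = c • matDeriv f p v := by
  ext i j
  simp only [Matrix.smul_apply, matDeriv_apply]
  exact map_smul _ c v

theorem SmoothMatAt.mdifferentiableAt {f : M → Mat2} {p : M} (hf : SmoothMatAt f p)
    (i j : Fin 2) : MDifferentiableAt (𝓡 2) 𝓘(ℝ, ℝ) (fun q => f q i j) p :=
  (hf i j).mdifferentiableAt (by simp)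

theorem smoothMatAt_const (c : Mat2) (p : M) : SmoothMatAt (fun _ => c) p :=
  fun _ _ => contMDiffAt_const

theorem matDeriv_const (c : Mat2) (p : M) (v : TangentSpace (𝓡 2) p) :
    matDeriv (fun _ => c) p v = 0 := by
  ext i j
  rw [matDeriv_apply, mfderiv_const]
  rfl

theorem SmoothMatAt.sub {f k : M → Mat2} {p : M} (hf : SmoothMatAt f p) (hk : SmoothMatAt k p) :
    SmoothMatAt (fun q => f q - k q) p :=
  fun i j => (hf i j).sub (hk i j)

theorem matDeriv_sub {f k : M → Mat2} {p : M} (hf : SmoothMatAt f p) (hk : SmoothMatAt k p)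
    (v : TangentSpace (𝓡 2) p) :
    matDeriv (fun q => f q - k q) p v = matDeriv f p v - matDeriv k p v := by
  ext i j
  have h := ((hf.mdifferentiableAt i j).hasMFDerivAt.sub
    (hk.mdifferentiableAt i j).hasMFDerivAt).mfderiv
  exact congrArg (fun L => L v) h

theorem SmoothMatAt.mul {f k : M → Mat2} {p : M} (hf : SmoothMatAt f p) (hk : SmoothMatAt k p) :
    SmoothMatAt (fun q => f q * k q) p := by
  intro i j
  simp only [Matrix.mul_apply, Fin.sum_univ_two]
  exact ((hf i 0).mul (hk 0 j)).add ((hf i 1).mul (hk 1 j))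

theorem matDeriv_mul {f k : M → Mat2} {p : M} (hf : SmoothMatAt f p) (hk : SmoothMatAt k p)
    (v : TangentSpace (𝓡 2) p) :
    matDeriv (fun q => f q * k q) p v = matDeriv f p v * k p + f p * matDeriv k p v := by
  ext i j
  have h := fun l => (hf.mdifferentiableAt i l).hasMFDerivAt.mul
    (hk.mdifferentiableAt l j).hasMFDerivAt
  have h' := congrArg (fun L => L v) ((h 0).add (h 1)).mfderiv
  have hfun : (fun q => (f q * k q) i j) =
      (fun q => f q i 0) * (fun q => k q 0 j) + (fun q => f q i 1) * (fun q => k q 1 j) := by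
    funext q
    simp [Matrix.mul_apply, Fin.sum_univ_two]
  rw [matDeriv_apply, hfun]
  simp only [Matrix.add_apply, Matrix.mul_apply, Fin.sum_univ_two]
  refine Eq.trans h' ?_
  change f p i 0 * matDeriv k p v 0 j + k p 0 j * matDeriv f p v i 0 +
      (f p i 1 * matDeriv k p v 1 j + k p 1 j * matDeriv f p v i 1) = _
  ring

theorem SmoothMatAt.adjugate {f : M → Mat2} {p : M} (hf : SmoothMatAt f p) :
    SmoothMatAt (fun q => (f q).adjugate) p := by
  intro i j
  simp only [Matrix.adjugate_fin_two]
  fin_cases i <;> fin_cases j <;> simp <;>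
    first
      | exact hf _ _
      | exact (hf _ _).neg

theorem SmoothMatAt.det {f : M → Mat2} {p : M} (hf : SmoothMatAt f p) :
    ContMDiffAt (𝓡 2) 𝓘(ℝ, ℝ) ∞ (fun q => (f q).det) p := by
  simp only [Matrix.det_fin_two]
  exact ((hf 0 0).mul (hf 1 1)).sub ((hf 0 1).mul (hf 1 0))

theorem SmoothMatAt.congr {f k : M → Mat2} {p : M} (hf : SmoothMatAt f p)
    (h : k =ᶠ[nhds p] f) : SmoothMatAt k p :=
  fun i j => (hf i j).congr_of_eventuallyEq (h.mono fun _ hq => congrFun (congrFun hq i) j)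

/-- The derivative of the determinant on a matrix function of constant determinant. -/
theorem trace_adjugate_mul_matDeriv {f : M → Mat2} {p : M} (hf : SmoothMatAt f p) {c : ℝ}
    (hdet : ∀ q, (f q).det = c) (v : TangentSpace (𝓡 2) p) :
    ((f p).adjugate * matDeriv f p v).trace = 0 := by
  have h := fun i j => (hf.mdifferentiableAt i j).hasMFDerivAt
  have h1 := congrArg (fun L => L v)
    (((h 0 0).mul (h 1 1)).sub ((h 0 1).mul (h 1 0))).mfderiv
  have h2 : (fun q => f q 0 0) * (fun q => f q 1 1) - (fun q => f q 0 1) * (fun q => f q 1 0)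
      = fun _ => c := by
    funext q
    rw [← hdet q, Matrix.det_fin_two]
    rfl
  rw [h2, mfderiv_const] at h1
  have h3 : (0 : ℝ) =
      (f p 0 0 * matDeriv f p v 1 1 + f p 1 1 * matDeriv f p v 0 0) -
        (f p 0 1 * matDeriv f p v 1 0 + f p 1 0 * matDeriv f p v 0 1) := h1
  rw [Matrix.adjugate_fin_two, Matrix.trace_fin_two]
  simp only [Matrix.mul_apply, Fin.sum_univ_two]
  simp
  linarith

/-- Smooth vector fields act on smooth matrix functions. -/
theorem SmoothMatAt.matDeriv [IsManifold (𝓡 2) ∞ M] {f : M → Mat2} (hf : ∀ q, SmoothMatAt f q)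
    {p : M} {Y : (q : M) → TangentSpace (𝓡 2) q}
    (hY : ContMDiffAt (𝓡 2) (𝓡 2).tangent ∞
      (fun q => (⟨q, Y q⟩ : TangentBundle (𝓡 2) M)) p) :
    SmoothMatAt (fun q => matDeriv f q (Y q)) p := by
  intro i j
  have h1 : ContMDiff (𝓡 2) 𝓘(ℝ, ℝ) ∞ (fun q => f q i j) := fun q => hf q i j
  have h2 := h1.contMDiff_tangentMap (m := ∞) (by simp)
  exact (contMDiff_snd_tangentBundle_modelSpace ℝ 𝓘(ℝ, ℝ)).contMDiffAt.comp p
    (h2.contMDiffAt.comp p hY)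

/-- A matrix function with vanishing derivative on a connected manifold is constant. -/
theorem eq_of_matDeriv_eq_zero [IsManifold (𝓡 2) ∞ M] [ConnectedSpace M] {f : M → Mat2}
    (hf : ∀ q, SmoothMatAt f q) (h0 : ∀ p v, NKSL.matDeriv f p v = 0) (p q : M) :
    f p = f q := by
  refine IsLocallyConstant.apply_eq_of_preconnectedSpace ?_ p q
  rw [IsLocallyConstant.iff_eventually_eq]
  intro x
  set e := chartAt (EuclideanSpace ℝ (Fin 2)) x with he
  have hx : x ∈ e.source := mem_chart_source _ x
  -- A ball inside the chart target is convex, so a vanishing derivative gives constancy there.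
  obtain ⟨r, hr, hball⟩ := Metric.isOpen_iff.1 e.open_target (e x) (e.map_source hx)
  have hev : ∀ᶠ z in nhds x, z ∈ e.source ∧ e z ∈ Metric.ball (e x) r := by
    refine Filter.Eventually.and (e.open_source.mem_nhds hx) ?_
    exact (e.continuousAt hx).eventually (Metric.ball_mem_nhds _ hr)
  filter_upwards [hev] with z ⟨hz, hzb⟩
  ext i j
  have hd : ∀ w ∈ e.target, HasFDerivAt (fun w => f (e.symm w) i j) (0 : _ →L[ℝ] ℝ) w := by
    intro w hw
    have h1 := ((hf (e.symm w)).mdifferentiableAt i j).hasMFDerivAt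
    have h2 : mfderiv (𝓡 2) 𝓘(ℝ, ℝ) (fun q => f q i j) (e.symm w) = 0 := by
      ext v
      exact congrFun (congrFun (h0 (e.symm w) v) i) j
    have h3 := (mdifferentiableAt_atlas_symm (I := 𝓡 2)
      (chart_mem_atlas (EuclideanSpace ℝ (Fin 2)) x) hw).hasMFDerivAt
    have h4 := HasMFDerivAt.comp w h1 h3
    rw [h2] at h4
    have h5 := hasMFDerivAt_iff_hasFDerivAt.1 h4
    refine h5.congr_fderiv ?_
    ext v
    rfl
  have hc := (convex_ball (e x) r).is_const_of_fderivWithin_eq_zero (𝕜 := ℝ)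
    (f := fun w => f (e.symm w) i j)
    (fun w hw => (hd w (hball hw)).differentiableAt.differentiableWithinAt)
    (fun w hw => by
      rw [fderivWithin_of_isOpen Metric.isOpen_ball hw, (hd w (hball hw)).fderiv]) hzb
    (Metric.mem_ball_self hr)
  simpa [e.left_inv hz, e.left_inv hx] using hc

end MatrixCalculus

/-! ### Pointwise algebra in the left trivialisation -/

section Algebra

theorem pull_push (x : Amb) (a : Mat2 × Mat2) : pull x (push x a) = a := by
  simp only [pull, push, ← Matrix.mul_assoc, ← Matrix.SpecialLinearGroup.coe_mul,
    inv_mul_cancel, Matrix.SpecialLinearGroup.coe_one, Matrix.one_mul]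

theorem push_pull (x : Amb) (Z : Mat2 × Mat2) : push x (pull x Z) = Z := by
  simp only [pull, push, ← Matrix.mul_assoc, ← Matrix.SpecialLinearGroup.coe_mul,
    mul_inv_cancel, Matrix.SpecialLinearGroup.coe_one, Matrix.one_mul]

theorem pull_J (x : Amb) (Z : Mat2 × Mat2) :
    pull x (J x Z) = ((1 / √3 : ℝ) • ((pull x Z).1 - (2 : ℝ) • (pull x Z).2),
      (1 / √3 : ℝ) • ((2 : ℝ) • (pull x Z).1 - (pull x Z).2)) := by
  rw [J, pull_push]

theorem pull_P (x : Amb) (Z : Mat2 × Mat2) :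
    pull x (P x Z) = ((pull x Z).2, (pull x Z).1) := by
  rw [P, pull_push]

/-- The metric in terms of the left trivialisation. -/
theorem g_eq (x : Amb) (Z W : Mat2 × Mat2) :
    g x Z W = 2 / 3 * (ip (pull x Z).1 (pull x W).1 + ip (pull x Z).2 (pull x W).2) -
      1 / 3 * (ip (pull x Z).2 (pull x W).1 + ip (pull x Z).1 (pull x W).2) := by
  conv_lhs => rw [← push_pull x Z, ← push_pull x W, g_push]
  simp [g, prodMetric, P, push, pull]

/-- A vector orthogonal to its images under `P` and `JP` has components spanning a plane in a
fixed conformal position. -/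
theorem ip_relations (x : Amb) (Z : Mat2 × Mat2) (h1 : g x (P x Z) Z = 0)
    (h2 : g x (P x Z) (J x Z) = 0) :
    ip (pull x Z).2 (pull x Z).2 = ip (pull x Z).1 (pull x Z).1 ∧
      2 * ip (pull x Z).1 (pull x Z).2 = ip (pull x Z).1 (pull x Z).1 := by
  have h3 : (0 : ℝ) < √3 := by positivity
  -- For `Z = (Aα, Bβ)`, `h1` becomes `4⟨α,β⟩ = ⟨α,α⟩ + ⟨β,β⟩` and `h2` becomes `⟨α,α⟩ = ⟨β,β⟩`.
  rw [g_eq, pull_P] at h1 h2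
  rw [pull_J] at h2
  generalize pull x Z = a at *
  obtain ⟨a, b⟩ := a
  simp only [ip, Matrix.smul_apply, Matrix.sub_apply, smul_eq_mul] at *
  field_simp at h2
  constructor <;> linarith

/-- Substituting `⟨β,β⟩ = ⟨α,α⟩ = 2⟨α,β⟩` leaves the coefficient `4/3 - 1/3 = 1` of `⟨α,α⟩`.
Together the two values show that `det α = 0` would make `Z` orthogonal to both `Z` and `JZ`. -/
theorem g_self_of_ip_relations (x : Amb) (Z : Mat2 × Mat2) (h1 : g x (P x Z) Z = 0)
    (h2 : g x (P x Z) (J x Z) = 0) :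
    g x Z Z = ip (pull x Z).1 (pull x Z).1 ∧ g x Z (J x Z) = 0 := by
  obtain ⟨r1, r2⟩ := ip_relations x Z h1 h2
  have h3 : (0 : ℝ) < √3 := by positivity
  rw [g_eq, g_eq, pull_J]
  generalize pull x Z = a at *
  obtain ⟨a, b⟩ := a
  simp only [ip, Matrix.smul_apply, Matrix.sub_apply, smul_eq_mul] at *
  constructor
  · linarith
  · field_simp
    linarith

theorem ip_self (a : Mat2) : ip a a = -a.det := by
  rw [ip, Matrix.det_fin_two]
  ring

/-- The Cayley-Hamilton theorem for trace one and determinant one. -/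
theorem mul_self_of_trace_one {U : Mat2} (htr : U.trace = 1) (hdet : U.det = 1) :
    U * U = U - 1 := by
  rw [Matrix.trace_fin_two] at htr
  rw [Matrix.det_fin_two] at hdet
  have h : U 1 1 = 1 - U 0 0 := by linarith
  ext i j
  fin_cases i <;> fin_cases j <;> simp [Matrix.mul_apply, Fin.sum_univ_two, h] <;>
    rw [h] at hdet <;> linarith

/-- The rotation `β α⁻¹` by the angle `π / 3`. -/
noncomputable def quotient (a b : Mat2) : Mat2 := (a.det)⁻¹ • (b * a.adjugate)

theorem quotient_mul {a b : Mat2} (ha : a.det ≠ 0) : quotient a b * a = b := by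
  rw [quotient, Matrix.smul_mul, Matrix.mul_assoc, Matrix.adjugate_mul, Matrix.mul_smul,
    Matrix.mul_one, smul_smul, inv_mul_cancel₀ ha, one_smul]

theorem det_quotient {a b : Mat2} (ha : a.det ≠ 0) (hab : ip b b = ip a a) :
    (quotient a b).det = 1 := by
  rw [ip_self, ip_self, neg_inj] at hab
  rw [quotient, Matrix.det_smul, Matrix.det_mul, Matrix.det_adjugate, hab]
  simp only [Fintype.card_fin, Nat.add_one_sub_one, pow_one]
  field_simp

/-- The form `ip` polarises `-det`, so `tr(b · adj a) = -2⟨a,b⟩` while `det a = -⟨a,a⟩`. -/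
theorem trace_quotient {a b : Mat2} (ha : a.det ≠ 0) (hab : 2 * ip a b = ip a a) :
    (quotient a b).trace = 1 := by
  rw [quotient, Matrix.trace_smul, smul_eq_mul, inv_mul_eq_iff_eq_mul₀ ha, mul_one]
  rw [ip_self] at hab
  rw [← neg_inj, ← hab, Matrix.trace_fin_two, Matrix.adjugate_fin_two, ip]
  simp [Matrix.mul_apply, Fin.sum_univ_two]
  ring

/-- Trace zero matrices orthogonal to the axis of `U` anticommute with that axis. -/
theorem mul_eq_mul_one_sub {U a : Mat2} (htr : U.trace = 1) (ha : a.trace = 0)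
    (hUa : (U * a).trace = 0) : a * U = (1 - U) * a := by
  rw [Matrix.trace_fin_two] at htr ha hUa
  simp only [Matrix.mul_apply, Fin.sum_univ_two] at hUa
  have h : U 1 1 = 1 - U 0 0 := by linarith
  have h' : a 1 1 = - a 0 0 := by linarith
  rw [h, h'] at hUa
  ext i j
  fin_cases i <;> fin_cases j <;> simp [Matrix.mul_apply, Fin.sum_univ_two, h, h'] <;> linarith

/-- If a graph rotates by `U`, whose derivative is `U'`, then the covariant derivative of a
tangent field in its own direction determines `U'`. -/
theorem rotation_deriv {U a U' : Mat2} (hUU : U * U = U - 1) (hdet : a.det ≠ 0)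
    (haU : a * U = (1 - U) * a)
    (hU' : U' * a = U * (leviCivita (a, U * a) (a, U * a)).1 -
      (leviCivita (a, U * a) (a, U * a)).2) :
    U' = -(a * U) := by
  -- The two connection components are `∓(2/3) a × Ua`, so `U'a = -(2/3)(U + 1)(a × Ua)`. Here `a ×
  -- Ua = (1/2)(1 - 2U)a²` and `(U + 1)(1 - 2U) = 3(1 - U)`, which leaves `-(1 - U)a² = -aUa`;
  -- invertibility of `a` then allows cancellation.
  have key : U' * a = -(a * U) * a := by
    rw [hU']
    have h1 : U * a * a = U * (a * a) := Matrix.mul_assoc _ _ _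
    have h2 : a * (U * a) = a * a - U * (a * a) := by
      rw [← Matrix.mul_assoc, haU, sub_mul, one_mul, sub_mul, h1]
    have h3 : U * (U * (a * a)) = U * (a * a) - a * a := by
      rw [← Matrix.mul_assoc, hUU, sub_mul, one_mul]
    have h4 : -(a * U) * a = -(a * a - U * (a * a)) := by
      rw [neg_mul, Matrix.mul_assoc, h2]
    simp only [leviCivita, cross, h4, sub_self, smul_zero, zero_sub, h1, h2, zero_add,
      mul_add, mul_sub, mul_neg, mul_smul_comm, h3]
    module
  have hu : IsUnit a := (Matrix.isUnit_iff_isUnit_det a).2 (isUnit_iff_ne_zero.2 hdet)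
  exact hu.mul_right_cancel key

end Algebra

/-! ### Almost complex surfaces whose tangent planes `P` makes normal -/

section SurfaceTheory

variable {M : Type*} [TopologicalSpace M] [ChartedSpace (EuclideanSpace ℝ (Fin 2)) M]

/-- The differential in the left trivialisation. -/
noncomputable def leftDiff (F : M → Amb) (p : M) (v : TangentSpace (𝓡 2) p) : Mat2 × Mat2 :=
  pull (F p) (differential F p v)

theorem leftDiff_fst (F : M → Amb) (p : M) (v : TangentSpace (𝓡 2) p) :
    (leftDiff F p v).1 =
      ((F p).1 : Mat2).adjugate * matDeriv (fun q => ((F q).1 : Mat2)) p v := by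
  rw [← Matrix.SpecialLinearGroup.coe_inv]
  rfl

theorem leftDiff_snd (F : M → Amb) (p : M) (v : TangentSpace (𝓡 2) p) :
    (leftDiff F p v).2 =
      ((F p).2 : Mat2).adjugate * matDeriv (fun q => ((F q).2 : Mat2)) p v := by
  rw [← Matrix.SpecialLinearGroup.coe_inv]
  rfl

theorem mul_leftDiff_fst (F : M → Amb) (p : M) (v : TangentSpace (𝓡 2) p) :
    ((F p).1 : Mat2) * (leftDiff F p v).1 = matDeriv (fun q => ((F q).1 : Mat2)) p v := by
  rw [leftDiff_fst, ← Matrix.mul_assoc, Matrix.mul_adjugate, (F p).1.det_coe, one_smul,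
    Matrix.one_mul]

theorem mul_leftDiff_snd (F : M → Amb) (p : M) (v : TangentSpace (𝓡 2) p) :
    ((F p).2 : Mat2) * (leftDiff F p v).2 = matDeriv (fun q => ((F q).2 : Mat2)) p v := by
  rw [leftDiff_snd, ← Matrix.mul_assoc, Matrix.mul_adjugate, (F p).2.det_coe, one_smul,
    Matrix.one_mul]

theorem leftDiff_add (F : M → Amb) (p : M) (v w : TangentSpace (𝓡 2) p) :
    leftDiff F p (v + w) = leftDiff F p v + leftDiff F p w := by
  ext1
  · simp only [Prod.fst_add, leftDiff_fst, matDeriv_add_right, mul_add]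
  · simp only [Prod.snd_add, leftDiff_snd, matDeriv_add_right, mul_add]

theorem leftDiff_smul (F : M → Amb) (p : M) (c : ℝ) (v : TangentSpace (𝓡 2) p) :
    leftDiff F p (c • v) = c • leftDiff F p v := by
  ext1
  · simp only [Prod.smul_fst, leftDiff_fst, matDeriv_smul_right, mul_smul_comm]
  · simp only [Prod.smul_snd, leftDiff_snd, matDeriv_smul_right, mul_smul_comm]

theorem IsSmooth.fst {F : M → Amb} (hF : IsSmooth F) (p : M) :
    SmoothMatAt (fun q => ((F q).1 : Mat2)) p := fun i j => (hF i j).1 p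

theorem IsSmooth.snd {F : M → Amb} (hF : IsSmooth F) (p : M) :
    SmoothMatAt (fun q => ((F q).2 : Mat2)) p := fun i j => (hF i j).2 p

theorem IsSmooth.trace_leftDiff_fst {F : M → Amb} (hF : IsSmooth F) (p : M)
    (v : TangentSpace (𝓡 2) p) : (leftDiff F p v).1.trace = 0 := by
  rw [leftDiff_fst]
  exact trace_adjugate_mul_matDeriv (hF.fst p) (fun q => (F q).1.det_coe) v

theorem IsSmooth.trace_leftDiff_snd {F : M → Amb} (hF : IsSmooth F) (p : M)
    (v : TangentSpace (𝓡 2) p) : (leftDiff F p v).2.trace = 0 := by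
  rw [leftDiff_snd]
  exact trace_adjugate_mul_matDeriv (hF.snd p) (fun q => (F q).2.det_coe) v

theorem inducedMetric_eq (F : M → Amb) (p : M) (v w : TangentSpace (𝓡 2) p) :
    inducedMetric F p v w =
      2 / 3 * (ip (leftDiff F p v).1 (leftDiff F p w).1 +
        ip (leftDiff F p v).2 (leftDiff F p w).2) -
      1 / 3 * (ip (leftDiff F p v).2 (leftDiff F p w).1 +
        ip (leftDiff F p v).1 (leftDiff F p w).2) := g_eq _ _ _

theorem inducedMetric_add_right (F : M → Amb) (p : M) (u v w : TangentSpace (𝓡 2) p) :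
    inducedMetric F p u (v + w) = inducedMetric F p u v + inducedMetric F p u w := by
  simp only [inducedMetric_eq, leftDiff_add, Prod.fst_add, Prod.snd_add, ip, Matrix.add_apply]
  ring

theorem inducedMetric_smul_right (F : M → Amb) (p : M) (c : ℝ) (u v : TangentSpace (𝓡 2) p) :
    inducedMetric F p u (c • v) = c * inducedMetric F p u v := by
  simp only [inducedMetric_eq, leftDiff_smul, Prod.smul_fst, Prod.smul_snd, ip,
    Matrix.smul_apply, smul_eq_mul]
  ring

/-- A complex line in the tangent plane is spanned by a vector and its image under `J`. -/
theorem IsAlmostComplexSurface.exists_J_basis {F : M → Amb} (hF : IsAlmostComplexSurface F)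
    (p : M) {v : TangentSpace (𝓡 2) p} (hv : v ≠ 0) :
    ∃ w : TangentSpace (𝓡 2) p, differential F p w = J (F p) (differential F p v) ∧
      ∀ u : TangentSpace (𝓡 2) p, ∃ s t : ℝ, u = s • v + t • w := by
  obtain ⟨w, hw⟩ := hF.complex p v
  refine ⟨w, hw, ?_⟩
  have h3 : √3 * √3 = (3 : ℝ) := Real.mul_self_sqrt (by norm_num)
  have h3' : √3 ≠ 0 := by positivity
  have hleft : leftDiff F p w = ((1 / √3 : ℝ) • ((leftDiff F p v).1 - (2 : ℝ) • (leftDiff F p v).2),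
      (1 / √3 : ℝ) • ((2 : ℝ) • (leftDiff F p v).1 - (leftDiff F p v).2)) := by
    rw [leftDiff, hw, pull_J]
    rfl
  have hzero : ∀ u : TangentSpace (𝓡 2) p, leftDiff F p u = 0 → u = 0 := by
    intro u hu
    apply hF.immersion p
    have h0 : leftDiff F p (0 : TangentSpace (𝓡 2) p) = 0 := by
      have := leftDiff_smul F p 0 u
      rwa [zero_smul, zero_smul] at this
    rw [← push_pull (F p) (differential F p u), ← push_pull (F p) (differential F p 0)]
    exact congrArg (push (F p)) (hu.trans h0.symm)
  have hli : LinearIndependent ℝ ![v, w] := by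
    rw [LinearIndependent.pair_iff]
    intro s t hst
    have h0 := congrArg (leftDiff F p) hst
    rw [leftDiff_add, leftDiff_smul, leftDiff_smul, hleft] at h0
    have hz : leftDiff F p (0 : TangentSpace (𝓡 2) p) = 0 := by
      have := leftDiff_smul F p 0 v
      rwa [zero_smul, zero_smul] at this
    rw [hz] at h0
    have e1 : ∀ i j, √3 * s * (leftDiff F p v).1 i j +
        t * ((leftDiff F p v).1 i j - 2 * (leftDiff F p v).2 i j) = 0 := by
      intro i j
      have := congrFun (congrFun (congrArg Prod.fst h0) i) j
      simp at this
      field_simp at this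
      linarith
    have e2 : ∀ i j, √3 * s * (leftDiff F p v).2 i j +
        t * (2 * (leftDiff F p v).1 i j - (leftDiff F p v).2 i j) = 0 := by
      intro i j
      have := congrFun (congrFun (congrArg Prod.snd h0) i) j
      simp at this
      field_simp at this
      linarith
    by_contra hne
    apply hv
    have hpos : s * s + t * t ≠ 0 := by
      intro h
      apply hne
      constructor <;> nlinarith [mul_self_nonneg s, mul_self_nonneg t]
    apply hzero
    ext i j
    · have : (s * s + t * t) * (leftDiff F p v).1 i j = 0 := by
        -- These coefficients apply `s - tJ` to the relation `(s + tJ)Z = 0`; since `J² = -1` the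
        -- result is `(s² + t²)Z = 0`. The other component is treated in the same way.
        linear_combination (√3 * s - t) / 3 * e1 i j + (2 * t) / 3 * e2 i j -
          s * s / 3 * (leftDiff F p v).1 i j * h3
      exact (mul_eq_zero.1 this).resolve_left hpos
    · have : (s * s + t * t) * (leftDiff F p v).2 i j = 0 := by
        linear_combination (√3 * s + t) / 3 * e2 i j - (2 * t) / 3 * e1 i j -
          s * s / 3 * (leftDiff F p v).2 i j * h3
      exact (mul_eq_zero.1 this).resolve_left hpos
  intro u
  have hspan : Submodule.span ℝ (Set.range ![v, w]) = ⊤ :=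
    hli.span_eq_top_of_card_eq_finrank (by
      change Fintype.card (Fin 2) = Module.finrank ℝ (EuclideanSpace ℝ (Fin 2))
      simp)
  have hu : u ∈ Submodule.span ℝ (Set.range ![v, w]) := hspan ▸ Submodule.mem_top
  rw [Matrix.range_cons, Matrix.range_cons, Matrix.range_empty, Set.union_empty,
    Set.singleton_union, Submodule.mem_span_pair] at hu
  obtain ⟨s, t, h⟩ := hu
  exact ⟨s, t, h.symm⟩

/-- If `det α = 0`, then `v` is null and orthogonal to its `J`-image; these two vectors span the
plane, so `v` lies in the radical of the induced metric. An indefinite `ip` would otherwise allow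
null `α`. -/
theorem IsAlmostComplexSurface.det_leftDiff_ne_zero {F : M → Amb}
    (hF : IsAlmostComplexSurface F) (hP : PMapsTangentToNormal F) (p : M)
    {v : TangentSpace (𝓡 2) p} (hv : v ≠ 0) : (leftDiff F p v).1.det ≠ 0 := by
  intro h0
  obtain ⟨w, hw, hspan⟩ := hF.exists_J_basis p hv
  have h2 := hP p v w
  rw [hw] at h2
  obtain ⟨e1, e2⟩ := g_self_of_ip_relations _ _ (hP p v v) h2
  have e1' : inducedMetric F p v v = 0 := by
    refine e1.trans ?_
    rw [ip_self]
    exact neg_eq_zero.2 h0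
  have e2' : inducedMetric F p v w = 0 := by
    rw [inducedMetric, hw, e2]
  apply hv
  apply hF.regular p v
  intro u
  obtain ⟨s, t, rfl⟩ := hspan u
  rw [inducedMetric_add_right, inducedMetric_smul_right, inducedMetric_smul_right, e1', e2']
  ring

/-- All tangent vectors `(Aα, Bβ)` at a point satisfy `β = U α` with the same `U`. -/
theorem IsAlmostComplexSurface.quotient_spec {F : M → Amb}
    (hF : IsAlmostComplexSurface F) (hP : PMapsTangentToNormal F) (p : M)
    {v : TangentSpace (𝓡 2) p} (hv : v ≠ 0) :
    (quotient (leftDiff F p v).1 (leftDiff F p v).2).trace = 1 ∧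
    (quotient (leftDiff F p v).1 (leftDiff F p v).2).det = 1 ∧
    ∀ w, (leftDiff F p w).2 =
      quotient (leftDiff F p v).1 (leftDiff F p v).2 * (leftDiff F p w).1 := by
  have hd := hF.det_leftDiff_ne_zero hP p hv
  obtain ⟨w, hw, hspan⟩ := hF.exists_J_basis p hv
  have h2 := hP p v w
  rw [hw] at h2
  obtain ⟨r1, r2⟩ := ip_relations _ _ (hP p v v) h2
  have htr := trace_quotient (b := (leftDiff F p v).2) hd r2
  have hdet := det_quotient (b := (leftDiff F p v).2) hd r1
  have hmul := quotient_mul (b := (leftDiff F p v).2) hd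
  refine ⟨htr, hdet, ?_⟩
  have hUU := mul_self_of_trace_one htr hdet
  have hleft : leftDiff F p w = ((1 / √3 : ℝ) • ((leftDiff F p v).1 - (2 : ℝ) • (leftDiff F p v).2),
      (1 / √3 : ℝ) • ((2 : ℝ) • (leftDiff F p v).1 - (leftDiff F p v).2)) := by
    rw [leftDiff, hw, pull_J]
    rfl
  change ∀ u, (leftDiff F p u).2 = quotient (leftDiff F p v).1 (leftDiff F p v).2 *
    (leftDiff F p u).1
  generalize quotient (leftDiff F p v).1 (leftDiff F p v).2 = U at *
  -- `Uβ = β - α` gives `U(α - 2β) = 2α - β`, so `JZ` satisfies the same relation as `Z`; linearity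
  -- extends it to the plane.
  have hUb : U * (leftDiff F p v).2 = (leftDiff F p v).2 - (leftDiff F p v).1 := by
    rw [← hmul, ← Matrix.mul_assoc, hUU, sub_mul, one_mul]
  intro u
  obtain ⟨s, t, rfl⟩ := hspan u
  rw [leftDiff_add, leftDiff_smul, leftDiff_smul, hleft]
  simp only [Prod.fst_add, Prod.snd_add, Prod.smul_fst, Prod.smul_snd, mul_add, mul_sub,
    mul_smul_comm, hmul, hUb]
  module

/-- `U` is chosen point by point; its smoothness is recovered afterwards from the relation `β = Uα`.
-/
theorem IsAlmostComplexSurface.exists_rotation {F : M → Amb}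
    (hF : IsAlmostComplexSurface F) (hP : PMapsTangentToNormal F) :
    ∃ U : M → SL2, ∀ p, (U p : Mat2).trace = 1 ∧
      ∀ v, (leftDiff F p v).2 = (U p : Mat2) * (leftDiff F p v).1 := by
  have h : ∀ p : M, ∃ U : SL2, (U : Mat2).trace = 1 ∧
      ∀ v, (leftDiff F p v).2 = (U : Mat2) * (leftDiff F p v).1 := by
    intro p
    have : Nontrivial (TangentSpace (𝓡 2) p) :=
      inferInstanceAs (Nontrivial (EuclideanSpace ℝ (Fin 2)))
    obtain ⟨v, hv⟩ := exists_ne (0 : TangentSpace (𝓡 2) p)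
    obtain ⟨h1, h2, h3⟩ := hF.quotient_spec hP p hv
    exact ⟨⟨_, h2⟩, h1, h3⟩
  choose U hU using h
  exact ⟨U, hU⟩

theorem SmoothMatAt.leftDiff_fst [IsManifold (𝓡 2) ∞ M] {F : M → Amb} (hF : IsSmooth F)
    {p : M} {Y : (q : M) → TangentSpace (𝓡 2) q}
    (hY : ContMDiffAt (𝓡 2) (𝓡 2).tangent ∞
      (fun q => (⟨q, Y q⟩ : TangentBundle (𝓡 2) M)) p) :
    SmoothMatAt (fun q => (leftDiff F q (Y q)).1) p := by
  simp only [NKSL.leftDiff_fst]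
  exact (hF.fst p).adjugate.mul (SmoothMatAt.matDeriv hF.fst hY)

theorem SmoothMatAt.leftDiff_snd [IsManifold (𝓡 2) ∞ M] {F : M → Amb} (hF : IsSmooth F)
    {p : M} {Y : (q : M) → TangentSpace (𝓡 2) q}
    (hY : ContMDiffAt (𝓡 2) (𝓡 2).tangent ∞
      (fun q => (⟨q, Y q⟩ : TangentBundle (𝓡 2) M)) p) :
    SmoothMatAt (fun q => (leftDiff F q (Y q)).2) p := by
  simp only [NKSL.leftDiff_snd]
  exact (hF.snd p).adjugate.mul (SmoothMatAt.matDeriv hF.snd hY)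

/-- Total geodesy is a condition on vector fields, so a single tangent vector must be extended
before it can be applied. -/
theorem exists_smooth_extension [IsManifold (𝓡 2) ∞ M] {p : M} (v : TangentSpace (𝓡 2) p) :
    ∃ Y : (q : M) → TangentSpace (𝓡 2) q, Y p = v ∧
      ContMDiffAt (𝓡 2) (𝓡 2).tangent ∞
        (fun q => (⟨q, Y q⟩ : TangentBundle (𝓡 2) M)) p :=
  ⟨FiberBundle.extend (EuclideanSpace ℝ (Fin 2)) v, FiberBundle.extend_apply_self _ _,
    FiberBundle.contMDiffAt_extend (𝓡 2) (EuclideanSpace ℝ (Fin 2)) v⟩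

/-! ### The rotation field `U` and its derivative -/

section Rotation

variable [IsManifold (𝓡 2) ∞ M] {F : M → Amb} {U : M → SL2}

/-- Along a local smooth field with nonzero value at `p`, the first component stays invertible near
`p`, and there `U` is a quotient of smooth functions. -/
theorem IsAlmostComplexSurface.smooth_rotation (hF : IsAlmostComplexSurface F)
    (hP : PMapsTangentToNormal F)
    (hU : ∀ p, ∀ v, (leftDiff F p v).2 = (U p : Mat2) * (leftDiff F p v).1) (p : M) :
    SmoothMatAt (fun q => (U q : Mat2)) p := by
  have : Nontrivial (TangentSpace (𝓡 2) p) :=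
    inferInstanceAs (Nontrivial (EuclideanSpace ℝ (Fin 2)))
  obtain ⟨v, hv⟩ := exists_ne (0 : TangentSpace (𝓡 2) p)
  obtain ⟨Y, hYp, hY⟩ := exists_smooth_extension v
  have ha := SmoothMatAt.leftDiff_fst hF.smooth hY
  have hb := SmoothMatAt.leftDiff_snd hF.smooth hY
  have hd : (leftDiff F p (Y p)).1.det ≠ 0 := by
    rw [hYp]
    exact hF.det_leftDiff_ne_zero hP p hv
  have hev : ∀ᶠ q in nhds p, (leftDiff F q (Y q)).1.det ≠ 0 :=
    ha.det.continuousAt.eventually_ne hd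
  have hs : SmoothMatAt (fun q => quotient (leftDiff F q (Y q)).1 (leftDiff F q (Y q)).2) p :=
    fun i j => (ha.det.inv₀ hd).mul ((hb.mul ha.adjugate) i j)
  refine hs.congr ?_
  filter_upwards [hev] with q hq
  have hu : IsUnit (leftDiff F q (Y q)).1 :=
    (Matrix.isUnit_iff_isUnit_det _).2 (isUnit_iff_ne_zero.2 hq)
  apply hu.mul_right_cancel
  rw [quotient_mul hq, hU]

/-- Tangency of `∇_Y Y` means that its second component is `U` times its first. Differentiating `β =
Uα`, the terms `U·dα` cancel, and `dU·α` is expressed through the connection alone, as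
`rotation_deriv` requires. -/
theorem IsAlmostComplexSurface.matDeriv_rotation (hF : IsAlmostComplexSurface F)
    (hgeo : IsTotallyGeodesic F) (hP : PMapsTangentToNormal F)
    (htr : ∀ p, (U p : Mat2).trace = 1)
    (hU : ∀ p, ∀ v, (leftDiff F p v).2 = (U p : Mat2) * (leftDiff F p v).1) (p : M)
    (v : TangentSpace (𝓡 2) p) :
    matDeriv (fun q => (U q : Mat2)) p v = -((leftDiff F p v).1 * (U p : Mat2)) := by
  -- The zero vector is separate because the cancellation needs `α` invertible.
  by_cases hv : v = 0
  · subst hv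
    have h1 : matDeriv (fun q => (U q : Mat2)) p (0 : TangentSpace (𝓡 2) p) = 0 := by
      have := matDeriv_smul_right (fun q => (U q : Mat2)) p 0 0
      rwa [zero_smul, zero_smul] at this
    have h2 : leftDiff F p (0 : TangentSpace (𝓡 2) p) = 0 := by
      have := leftDiff_smul F p 0 0
      rwa [zero_smul, zero_smul] at this
    rw [h1, h2]
    simp
  obtain ⟨Y, hYp, hY⟩ := exists_smooth_extension v
  have ha := SmoothMatAt.leftDiff_fst hF.smooth hY
  obtain ⟨w, hw⟩ := hgeo p Y hY v
  have hw' := congrArg (pull (F p)) hw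
  rw [covDeriv, pull_push, deriv2_eq] at hw'
  change (matDeriv (fun q => (leftDiff F q (Y q)).1) p v,
    matDeriv (fun q => (leftDiff F q (Y q)).2) p v) +
      leviCivita (leftDiff F p v) (leftDiff F p (Y p)) = leftDiff F p w at hw'
  have hb : (fun q => (leftDiff F q (Y q)).2) =
      fun q => (U q : Mat2) * (leftDiff F q (Y q)).1 := funext fun q => hU q _
  rw [hb, matDeriv_mul (hF.smooth_rotation hP hU p) ha v, hYp] at hw'
  have hpair : leftDiff F p v = ((leftDiff F p v).1, (U p : Mat2) * (leftDiff F p v).1) :=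
    Prod.ext rfl (hU p v)
  have hd := hF.det_leftDiff_ne_zero hP p hv
  have htra := hF.smooth.trace_leftDiff_fst p v
  have htrb := hF.smooth.trace_leftDiff_snd p v
  rw [hU] at htrb
  have e := hU p w
  rw [← hw', hpair] at e
  refine rotation_deriv (mul_self_of_trace_one (htr p) (U p).det_coe) hd
    (mul_eq_mul_one_sub (htr p) htra htrb) ?_
  simp only [Prod.fst_add, Prod.snd_add, mul_add] at e
  rw [add_right_comm, add_comm] at e
  have e' := sub_eq_zero.2 e
  rw [← sub_eq_zero, ← e']
  abel

/-- `dA = Aα` and `dU = -αU` give `d(AU) = AαU - AαU`. -/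
theorem IsAlmostComplexSurface.matDeriv_fst_mul_rotation (hF : IsAlmostComplexSurface F)
    (hgeo : IsTotallyGeodesic F) (hP : PMapsTangentToNormal F)
    (htr : ∀ p, (U p : Mat2).trace = 1)
    (hU : ∀ p, ∀ v, (leftDiff F p v).2 = (U p : Mat2) * (leftDiff F p v).1) (p : M)
    (v : TangentSpace (𝓡 2) p) :
    matDeriv (fun q => ((F q).1 : Mat2) * (U q : Mat2)) p v = 0 := by
  rw [matDeriv_mul (hF.smooth.fst p) (hF.smooth_rotation hP hU p),
    hF.matDeriv_rotation hgeo hP htr hU, ← mul_leftDiff_fst, mul_neg, Matrix.mul_assoc,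
    add_neg_cancel]

/-- Here `1 - U` is `U⁻¹`. The derivative is `B(Uα(1 - U) + αU)`, which vanishes by `αU = (1 - U)α`
and `U² = U - 1`. -/
theorem IsAlmostComplexSurface.matDeriv_snd_mul_rotation_inv (hF : IsAlmostComplexSurface F)
    (hgeo : IsTotallyGeodesic F) (hP : PMapsTangentToNormal F)
    (htr : ∀ p, (U p : Mat2).trace = 1)
    (hU : ∀ p, ∀ v, (leftDiff F p v).2 = (U p : Mat2) * (leftDiff F p v).1) (p : M)
    (v : TangentSpace (𝓡 2) p) :
    matDeriv (fun q => ((F q).2 : Mat2) * (1 - (U q : Mat2))) p v = 0 := by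
  have hs := hF.smooth_rotation hP hU p
  have hone := smoothMatAt_const (M := M) 1 p
  have htra := hF.smooth.trace_leftDiff_fst p v
  have htrb := hF.smooth.trace_leftDiff_snd p v
  rw [hU] at htrb
  have haU := mul_eq_mul_one_sub (htr p) htra htrb
  have hUU := mul_self_of_trace_one (htr p) (U p).det_coe
  rw [matDeriv_mul (hF.smooth.snd p) (hone.sub hs), matDeriv_sub hone hs, matDeriv_const,
    hF.matDeriv_rotation hgeo hP htr hU, ← mul_leftDiff_snd, hU, Matrix.mul_assoc, ← mul_add]
  have : (U p : Mat2) * (leftDiff F p v).1 * (1 - (U p : Mat2)) +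
      (0 - -((leftDiff F p v).1 * (U p : Mat2))) = 0 := by
    rw [mul_sub, mul_one, Matrix.mul_assoc, haU, ← Matrix.mul_assoc, mul_sub, hUU]
    noncomm_ring
  rw [this, mul_zero]

end Rotation

end SurfaceTheory

/-! ### Curvature of surfaces in the Lorentzian quadric -/

section HyperbolicCurvature

/-- The Lorentz form whose unit timelike vectors form the quadric. -/
def lorentz (u v : Fin 3 → ℝ) : ℝ := u 0 * v 0 + u 1 * v 1 - u 2 * v 2

theorem lorentz_zero_left (v : Fin 3 → ℝ) : lorentz 0 v = 0 := by
  simp [lorentz]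

theorem pd_add {f k : Plane → ℝ} {x : Plane} (i : Fin 2) (hf : DifferentiableAt ℝ f x)
    (hk : DifferentiableAt ℝ k x) :
    pd i (fun z => f z + k z) x = pd i f x + pd i k x := by
  rw [pd, fderiv_fun_add hf hk]
  rfl

theorem pd_mul {f k : Plane → ℝ} {x : Plane} (i : Fin 2) (hf : DifferentiableAt ℝ f x)
    (hk : DifferentiableAt ℝ k x) :
    pd i (fun z => f z * k z) x = pd i f x * k x + f x * pd i k x := by
  rw [pd, fderiv_fun_mul hf hk]
  change f x * pd i k x + k x * pd i f x = _
  ring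

theorem pd_const (c : ℝ) (i : Fin 2) (x : Plane) : pd i (fun _ => c) x = 0 := by
  simp [pd]

theorem pd_const_mul {f : Plane → ℝ} {x : Plane} (c : ℝ) (i : Fin 2)
    (hf : DifferentiableAt ℝ f x) : pd i (fun z => c * f z) x = c * pd i f x := by
  rw [pd_mul i (differentiableAt_const c) hf, pd_const]
  ring

theorem pd_congr {f k : Plane → ℝ} {O : Set Plane} (hO : IsOpen O) {x : Plane} (hx : x ∈ O)
    (h : ∀ z ∈ O, f z = k z) (i : Fin 2) : pd i f x = pd i k x := by
  rw [pd, Filter.EventuallyEq.fderiv_eq (Filter.eventuallyEq_of_mem (hO.mem_nhds hx) h)]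
  rfl

theorem pd_lorentz {u v : Fin 3 → Plane → ℝ} {x : Plane} (i : Fin 2)
    (hu : ∀ k, DifferentiableAt ℝ (u k) x) (hv : ∀ k, DifferentiableAt ℝ (v k) x) :
    pd i (fun z => lorentz (fun k => u k z) (fun k => v k z)) x =
      lorentz (fun k => pd i (u k) x) (fun k => v k x) +
        lorentz (fun k => u k x) (fun k => pd i (v k) x) := by
  have h : (fun z => lorentz (fun k => u k z) (fun k => v k z)) =
      fun z => (u 0 z * v 0 z + u 1 z * v 1 z) + (-1) * (u 2 z * v 2 z) := by
    funext z
    simp only [lorentz]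
    ring
  rw [h, pd_add i (((hu 0).fun_mul (hv 0)).fun_add ((hu 1).fun_mul (hv 1)))
    (((hu 2).fun_mul (hv 2)).const_mul _), pd_add i ((hu 0).fun_mul (hv 0)) ((hu 1).fun_mul (hv 1)),
    pd_const_mul _ i ((hu 2).fun_mul (hv 2)), pd_mul i (hu 0) (hv 0), pd_mul i (hu 1) (hv 1),
    pd_mul i (hu 2) (hv 2)]
  simp only [lorentz]
  ring

theorem contDiffOn_pd {f : Plane → ℝ} {O : Set Plane} (hO : IsOpen O)
    (hf : ContDiffOn ℝ ∞ f O) (i : Fin 2) : ContDiffOn ℝ ∞ (pd i f) O :=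
  (hf.fderiv_of_isOpen hO (by simp)).clm_apply contDiffOn_const

theorem differentiableAt_of_contDiffOn {f : Plane → ℝ} {O : Set Plane} (hO : IsOpen O)
    (hf : ContDiffOn ℝ ∞ f O) {x : Plane} (hx : x ∈ O) : DifferentiableAt ℝ f x :=
  (hf.contDiffAt (hO.mem_nhds hx)).differentiableAt (by simp)

theorem pd_comm {f : Plane → ℝ} {O : Set Plane} (hO : IsOpen O)
    (hf : ContDiffOn ℝ ∞ f O) {x : Plane} (hx : x ∈ O) (i j : Fin 2) :
    pd i (pd j f) x = pd j (pd i f) x := by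
  have hd : DifferentiableAt ℝ (fderiv ℝ f) x :=
    ((hf.fderiv_of_isOpen hO (m := ∞) (by simp)).contDiffAt (hO.mem_nhds hx)).differentiableAt
      (by simp)
  have key : ∀ i j : Fin 2, pd i (pd j f) x =
      fderiv ℝ (fderiv ℝ f) x (EuclideanSpace.single i 1) (EuclideanSpace.single j 1) := by
    intro i j
    have h := (hd.hasFDerivAt.clm_apply
      (hasFDerivAt_const (EuclideanSpace.single j (1 : ℝ) : Plane) x)).fderiv
    change fderiv ℝ (fun z => fderiv ℝ f z (EuclideanSpace.single j 1)) x _ = _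
    rw [h]
    simp
  rw [key, key]
  have hs : IsSymmSndFDerivAt ℝ f x :=
    (hf.contDiffAt (hO.mem_nhds hx)).isSymmSndFDerivAt (by simpa using WithTop.coe_le_coe.2 (le_top (a := (2 : ℕ∞))))
  exact hs _ _

theorem contDiffOn_lorentz {u v : Fin 3 → Plane → ℝ} {O : Set Plane}
    (hu : ∀ k, ContDiffOn ℝ ∞ (u k) O) (hv : ∀ k, ContDiffOn ℝ ∞ (v k) O) :
    ContDiffOn ℝ ∞ (fun z => lorentz (fun k => u k z) (fun k => v k z)) O :=
  (((hu 0).mul (hv 0)).add ((hu 1).mul (hv 1))).sub ((hu 2).mul (hv 2))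

theorem contDiffOn_inv_entry {h : Plane → Mat2} {O : Set Plane}
    (hh : ∀ i j, ContDiffOn ℝ ∞ (fun z => h z i j) O) (hdet : ∀ z ∈ O, (h z).det ≠ 0)
    (k l : Fin 2) : ContDiffOn ℝ ∞ (fun z => (h z)⁻¹ k l) O := by
  have hd : ContDiffOn ℝ ∞ (fun z => (h z).det) O := by
    simp only [Matrix.det_fin_two]
    exact ((hh 0 0).mul (hh 1 1)).sub ((hh 0 1).mul (hh 1 0))
  have ha : ContDiffOn ℝ ∞ (fun z => (h z).adjugate k l) O := by
    simp only [Matrix.adjugate_fin_two]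
    fin_cases k <;> fin_cases l <;> simp <;>
      first
        | exact hh _ _
        | exact (hh _ _).neg
  refine ((hd.inv hdet).mul ha).congr fun z _ => ?_
  rw [Matrix.inv_def, Ring.inverse_eq_inv', Matrix.smul_apply, smul_eq_mul]
  rfl

theorem contDiffOn_christoffel {h : Plane → Mat2} {O : Set Plane} (hO : IsOpen O)
    (hh : ∀ i j, ContDiffOn ℝ ∞ (fun z => h z i j) O) (hdet : ∀ z ∈ O, (h z).det ≠ 0)
    (k i j : Fin 2) : ContDiffOn ℝ ∞ (christoffel h k i j) O := by
  have hl : ∀ l, ContDiffOn ℝ ∞ (fun x => (h x)⁻¹ k l *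
      (pd i (fun z => h z j l) x + pd j (fun z => h z i l) x - pd l (fun z => h z i j) x)) O :=
    fun l => (contDiffOn_inv_entry hh hdet k l).mul
      (((contDiffOn_pd hO (hh j l) i).add (contDiffOn_pd hO (hh i l) j)).sub
        (contDiffOn_pd hO (hh i j) l))
  have := contDiffOn_const (c := (1 / 2 : ℝ)).mul ((hl 0).add (hl 1))
  refine this.congr fun z _ => ?_
  simp only [christoffel, Fin.sum_univ_two]

/-- A vector orthogonal to a frame of nonzero Gram determinant vanishes. -/
theorem eq_zero_of_lorentz_orthogonal {a b n w : Fin 3 → ℝ}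
    (hn : lorentz n n = -1) (han : lorentz a n = 0) (hbn : lorentz b n = 0)
    (hd : lorentz a a * lorentz b b - lorentz a b * lorentz a b ≠ 0)
    (ha : lorentz w a = 0) (hb : lorentz w b = 0) (hwn : lorentz w n = 0) : w = 0 := by
  have hdet : (Matrix.of ![a, b, n]).det ≠ 0 := by
    intro h0
    apply hd
    -- The square of the determinant is minus the Gram determinant, because the Lorentz form has
    -- determinant `-1`.
    have h1 : (Matrix.of ![a, b, n]).det ^ 2 =
        -(lorentz a a * (lorentz b b * lorentz n n - lorentz b n * lorentz b n) -
          lorentz a b * (lorentz a b * lorentz n n - lorentz b n * lorentz a n) +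
          lorentz a n * (lorentz a b * lorentz b n - lorentz b b * lorentz a n)) := by
      rw [Matrix.det_fin_three]
      simp only [lorentz, Matrix.of_apply, Matrix.cons_val]
      ring
    rw [h0, hn, han, hbn] at h1
    linarith
  -- The sign on the last entry turns Lorentz products with `w` into ordinary dot products.
  have h2 : (Matrix.of ![a, b, n]).mulVec ![w 0, w 1, -w 2] = 0 := by
    ext k
    fin_cases k <;> simp [Matrix.mulVec, dotProduct, Fin.sum_univ_three] <;>
      simp only [lorentz] at ha hb hwn <;> linarith
  have h3 := Matrix.eq_zero_of_mulVec_eq_zero hdet h2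
  ext k
  have h4 := congrFun h3 k
  fin_cases k <;> simpa using h4

variable {O : Set Plane} {y : Fin 3 → Plane → ℝ} {h : Plane → Mat2}

theorem lorentz_pd_self (hO : IsOpen O) (hy : ∀ k, ContDiffOn ℝ ∞ (y k) O)
    (hq : ∀ z ∈ O, lorentz (fun k => y k z) (fun k => y k z) = -1) {x : Plane} (hx : x ∈ O)
    (i : Fin 2) : lorentz (fun k => pd i (y k) x) (fun k => y k x) = 0 := by
  have hd := fun k => differentiableAt_of_contDiffOn hO (hy k) hx
  have h1 := pd_congr hO hx hq i
  rw [pd_lorentz i hd hd, pd_const] at h1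
  simp only [lorentz] at *
  linarith

/-- Differentiating `⟨∂ⱼy, y⟩ = 0` gives the component of `∂ᵢ∂ⱼy` along the normal `y`. -/
theorem lorentz_pd_pd_self (hO : IsOpen O) (hy : ∀ k, ContDiffOn ℝ ∞ (y k) O)
    (hq : ∀ z ∈ O, lorentz (fun k => y k z) (fun k => y k z) = -1) {x : Plane} (hx : x ∈ O)
    (i j : Fin 2) : lorentz (fun k => pd i (pd j (y k)) x) (fun k => y k x) =
      -lorentz (fun k => pd i (y k) x) (fun k => pd j (y k) x) := by
  have hd := fun k => differentiableAt_of_contDiffOn hO (hy k) hx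
  have hd' := fun k => differentiableAt_of_contDiffOn hO (contDiffOn_pd hO (hy k) j) hx
  have h1 := pd_congr hO hx (fun z hz => lorentz_pd_self hO hy hq hz j) i
  rw [pd_lorentz i hd' hd, pd_const] at h1
  simp only [lorentz] at *
  linarith

/-- Koszul's formula for a metric induced from the Lorentz form. -/
theorem sum_mul_christoffel {c : ℝ} (hO : IsOpen O) (hy : ∀ k, ContDiffOn ℝ ∞ (y k) O)
    (hh : ∀ z ∈ O, ∀ i j, h z i j =
      c * lorentz (fun k => pd i (y k) z) (fun k => pd j (y k) z))
    (hdet : ∀ z ∈ O, (h z).det ≠ 0) {x : Plane} (hx : x ∈ O) (l i j : Fin 2) :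
    h x l 0 * christoffel h 0 i j x + h x l 1 * christoffel h 1 i j x =
      c * lorentz (fun k => pd i (pd j (y k)) x) (fun k => pd l (y k) x) := by
  have hd := fun k i => differentiableAt_of_contDiffOn hO (contDiffOn_pd hO (hy k) i) hx
  have hpd : ∀ i j l, pd i (fun z => h z j l) x =
      c * (lorentz (fun k => pd i (pd j (y k)) x) (fun k => pd l (y k) x) +
        lorentz (fun k => pd j (y k) x) (fun k => pd i (pd l (y k)) x)) := by
    intro i j l
    rw [pd_congr hO hx (fun z hz => hh z hz j l) i, pd_const_mul, pd_lorentz i]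
    · exact fun k => hd k j
    · exact fun k => hd k l
    · exact differentiableAt_of_contDiffOn hO (contDiffOn_lorentz
        (fun k => contDiffOn_pd hO (hy k) j) (fun k => contDiffOn_pd hO (hy k) l)) hx
  -- The product rule yields six terms; symmetry of second partials cancels four, and the remaining
  -- two coincide.
  have hkos : ∀ l, 1 / 2 * (pd i (fun z => h z j l) x + pd j (fun z => h z i l) x -
      pd l (fun z => h z i j) x) =
      c * lorentz (fun k => pd i (pd j (y k)) x) (fun k => pd l (y k) x) := by
    intro l
    rw [hpd, hpd, hpd]
    simp only [fun k => pd_comm hO (hy k) hx j i, fun k => pd_comm hO (hy k) hx l i,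
      fun k => pd_comm hO (hy k) hx l j]
    simp only [lorentz]
    ring
  have hinv : h x * (h x)⁻¹ = 1 := Matrix.mul_nonsing_inv _ (isUnit_iff_ne_zero.2 (hdet x hx))
  have hinv' : ∀ m, h x l 0 * (h x)⁻¹ 0 m + h x l 1 * (h x)⁻¹ 1 m = (1 : Mat2) l m := by
    intro m
    rw [← hinv, Matrix.mul_apply, Fin.sum_univ_two]
  rw [← hkos l]
  simp only [christoffel, Fin.sum_univ_two]
  have h0 := hinv' 0
  have h1 := hinv' 1
  obtain rfl | rfl : l = 0 ∨ l = 1 := by omega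
  · simp at h0 h1 ⊢
    linear_combination
      (1 / 2 * (pd i (fun z => h z j 0) x + pd j (fun z => h z i 0) x -
        pd 0 (fun z => h z i j) x)) * h0 +
      (1 / 2 * (pd i (fun z => h z j 1) x + pd j (fun z => h z i 1) x -
        pd 1 (fun z => h z i j) x)) * h1
  · simp at h0 h1 ⊢
    linear_combination
      (1 / 2 * (pd i (fun z => h z j 0) x + pd j (fun z => h z i 0) x -
        pd 0 (fun z => h z i j) x)) * h0 +
      (1 / 2 * (pd i (fun z => h z j 1) x + pd j (fun z => h z i 1) x -
        pd 1 (fun z => h z i j) x)) * h1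

/-- The Gauss formula for a surface in the quadric. -/
theorem gauss_formula {c : ℝ} (hc : c ≠ 0) (hO : IsOpen O)
    (hy : ∀ k, ContDiffOn ℝ ∞ (y k) O)
    (hq : ∀ z ∈ O, lorentz (fun k => y k z) (fun k => y k z) = -1)
    (hh : ∀ z ∈ O, ∀ i j, h z i j =
      c * lorentz (fun k => pd i (y k) z) (fun k => pd j (y k) z))
    (hdet : ∀ z ∈ O, (h z).det ≠ 0) {x : Plane} (hx : x ∈ O) (i j : Fin 2) (k : Fin 3) :
    pd i (pd j (y k)) x =
      christoffel h 0 i j x * pd 0 (y k) x + christoffel h 1 i j x * pd 1 (y k) x +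
        lorentz (fun k => pd i (y k) x) (fun k => pd j (y k) x) * y k x := by
  have t0 := lorentz_pd_self hO hy hq hx 0
  have t1 := lorentz_pd_self hO hy hq hx 1
  have hn := hq x hx
  have k0 := sum_mul_christoffel hO hy hh hdet hx 0 i j
  have k1 := sum_mul_christoffel hO hy hh hdet hx 1 i j
  have hs := lorentz_pd_pd_self hO hy hq hx i j
  have hd := hdet x hx
  rw [Matrix.det_fin_two] at hd
  simp only [hh x hx] at k0 k1 hd
  have k0' := mul_left_cancel₀ hc (k0.symm.trans (by ring :
    _ = c * (lorentz (fun k => pd 0 (y k) x) (fun k => pd 0 (y k) x) * christoffel h 0 i j x +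
      lorentz (fun k => pd 0 (y k) x) (fun k => pd 1 (y k) x) * christoffel h 1 i j x)))
  have k1' := mul_left_cancel₀ hc (k1.symm.trans (by ring :
    _ = c * (lorentz (fun k => pd 1 (y k) x) (fun k => pd 0 (y k) x) * christoffel h 0 i j x +
      lorentz (fun k => pd 1 (y k) x) (fun k => pd 1 (y k) x) * christoffel h 1 i j x)))
  have hd' : lorentz (fun k => pd 0 (y k) x) (fun k => pd 0 (y k) x) *
      lorentz (fun k => pd 1 (y k) x) (fun k => pd 1 (y k) x) -
      lorentz (fun k => pd 0 (y k) x) (fun k => pd 1 (y k) x) *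
      lorentz (fun k => pd 0 (y k) x) (fun k => pd 1 (y k) x) ≠ 0 := by
    intro h0
    apply hd
    have hsy : lorentz (fun k => pd 1 (y k) x) (fun k => pd 0 (y k) x) =
        lorentz (fun k => pd 0 (y k) x) (fun k => pd 1 (y k) x) := by
      simp only [lorentz]
      ring
    rw [hsy]
    linear_combination c * c * h0
  -- The difference of the two sides is orthogonal to `∂₀y`, `∂₁y` (Koszul) and to `y`. The normal
  -- coefficient is `+⟨∂ᵢy, ∂ⱼy⟩` because `⟨y,y⟩ = -1`.
  have hw := eq_zero_of_lorentz_orthogonal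
    (w := fun k => pd i (pd j (y k)) x - (christoffel h 0 i j x * pd 0 (y k) x +
      christoffel h 1 i j x * pd 1 (y k) x +
        lorentz (fun k => pd i (y k) x) (fun k => pd j (y k) x) * y k x)) hn t0 t1 hd' ?_ ?_ ?_
  · exact sub_eq_zero.1 (congrFun hw k)
  · generalize lorentz (fun k => pd i (y k) x) (fun k => pd j (y k) x) = H
    simp only [lorentz] at *
    linear_combination k0' - H * t0
  · generalize lorentz (fun k => pd i (y k) x) (fun k => pd j (y k) x) = H
    simp only [lorentz] at *
    linear_combination k1' - H * t1
  · generalize lorentz (fun k => pd i (y k) x) (fun k => pd j (y k) x) = H at *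
    simp only [lorentz] at *
    linear_combination hs - christoffel h 0 i j x * t0 - christoffel h 1 i j x * t1 - H * hn

/-- The curvature of the multiple by `c` of the metric of the hyperbolic plane is `-1 / c`. -/
theorem gaussCurvature_of_quadric {c : ℝ} (hc : c ≠ 0) (hO : IsOpen O)
    (hy : ∀ k, ContDiffOn ℝ ∞ (y k) O)
    (hq : ∀ z ∈ O, lorentz (fun k => y k z) (fun k => y k z) = -1)
    (hh : ∀ z ∈ O, ∀ i j, h z i j =
      c * lorentz (fun k => pd i (y k) z) (fun k => pd j (y k) z))
    (hdet : ∀ z ∈ O, (h z).det ≠ 0) {x : Plane} (hx : x ∈ O) :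
    gaussCurvature h x = -1 / c := by
  have hT := fun k i => contDiffOn_pd hO (hy k) i
  have hL := fun i j => contDiffOn_lorentz (fun k => hT k i) (fun k => hT k j)
  have hsm : ∀ i j, ContDiffOn ℝ ∞ (fun z => h z i j) O := fun i j =>
    (contDiffOn_const.mul (hL i j)).congr fun z hz => hh z hz i j
  have hG := fun k i j => contDiffOn_christoffel hO hsm hdet k i j
  have third : ∀ i j m k, pd m (pd i (pd j (y k))) x =
      pd m (christoffel h 0 i j) x * pd 0 (y k) x +
        christoffel h 0 i j x * pd m (pd 0 (y k)) x +
      (pd m (christoffel h 1 i j) x * pd 1 (y k) x +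
        christoffel h 1 i j x * pd m (pd 1 (y k)) x) +
      (pd m (fun z => lorentz (fun k => pd i (y k) z) (fun k => pd j (y k) z)) x * y k x +
        lorentz (fun k => pd i (y k) x) (fun k => pd j (y k) x) * pd m (y k) x) := by
    intro i j m k
    have D : ∀ {f : Plane → ℝ}, ContDiffOn ℝ ∞ f O → DifferentiableAt ℝ f x :=
      fun hf => differentiableAt_of_contDiffOn hO hf hx
    rw [pd_congr hO hx (fun z hz => gauss_formula hc hO hy hq hh hdet hz i j k) m,
      pd_add m (D (((hG 0 i j).mul (hT k 0)).add ((hG 1 i j).mul (hT k 1))))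
        (D ((hL i j).mul (hy k))),
      pd_add m (D ((hG 0 i j).mul (hT k 0))) (D ((hG 1 i j).mul (hT k 1))),
      pd_mul m (D (hG 0 i j)) (D (hT k 0)), pd_mul m (D (hG 1 i j)) (D (hT k 1)),
      pd_mul m (D (hL i j)) (D (hy k))]
  -- This is `∂₀(∂₁∂₁y) = ∂₁(∂₀∂₁y)` expanded by the Gauss formula. The witness `n` collects the
  -- coefficient of `y`; its value is immaterial, since `y ⊥ ∂₀y`.
  have codazzi : ∃ n : ℝ, ∀ k, riemann h 0 0 1 1 x * pd 0 (y k) x +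
      riemann h 1 0 1 1 x * pd 1 (y k) x + n * y k x +
      lorentz (fun k => pd 1 (y k) x) (fun k => pd 1 (y k) x) * pd 0 (y k) x -
      lorentz (fun k => pd 0 (y k) x) (fun k => pd 1 (y k) x) * pd 1 (y k) x = 0 := by
    refine ⟨christoffel h 0 1 1 x * lorentz (fun k => pd 0 (y k) x) (fun k => pd 0 (y k) x) +
      christoffel h 1 1 1 x * lorentz (fun k => pd 0 (y k) x) (fun k => pd 1 (y k) x) -
      christoffel h 0 0 1 x * lorentz (fun k => pd 1 (y k) x) (fun k => pd 0 (y k) x) -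
      christoffel h 1 0 1 x * lorentz (fun k => pd 1 (y k) x) (fun k => pd 1 (y k) x) +
      pd 0 (fun z => lorentz (fun k => pd 1 (y k) z) (fun k => pd 1 (y k) z)) x -
      pd 1 (fun z => lorentz (fun k => pd 0 (y k) z) (fun k => pd 1 (y k) z)) x, ?_⟩
    intro k
    have e := pd_comm hO (hT k 1) hx 0 1
    rw [third, third] at e
    simp only [fun i j => gauss_formula hc hO hy hq hh hdet hx i j k] at e
    simp only [riemann, Fin.sum_univ_two]
    linear_combination e
  obtain ⟨n, hn⟩ := codazzi
  have t0 := lorentz_pd_self hO hy hq hx 0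
  have hd := hdet x hx
  rw [gaussCurvature, div_eq_div_iff hd hc, Matrix.det_fin_two]
  simp only [Fin.sum_univ_two, hh x hx]
  simp only [lorentz] at *
  -- The Lorentz product of the vector identity with `∂₀y` isolates the curvature component.
  linear_combination c * c * (pd 0 (y 0) x * hn 0 + pd 0 (y 1) x * hn 1 - pd 0 (y 2) x * hn 2) -
    c * c * n * t0

end HyperbolicCurvature

/-! ### Quadric coordinates of `U` and the induced metric -/

section Congruence

/-- The point `y` of the quadric with `modelB y = U`, for `U` of trace and determinant one. -/
noncomputable def quadricCoord (U : Mat2) : Fin 3 → ℝ :=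
  ![(1 - 2 * U 0 0) / √3, -(U 0 1 + U 1 0) / √3, -(U 0 1 - U 1 0) / √3]

theorem quadricCoord_mem {U : Mat2} (htr : U.trace = 1) (hdet : U.det = 1) :
    quadricCoord U ∈ Quadric := by
  have h3 : √3 ^ 2 = (3 : ℝ) := Real.sq_sqrt (by norm_num)
  rw [Matrix.trace_fin_two] at htr
  rw [Matrix.det_fin_two] at hdet
  have h : U 1 1 = 1 - U 0 0 := by linarith
  rw [h] at hdet
  change ((1 - 2 * U 0 0) / √3) ^ 2 + (-(U 0 1 + U 1 0) / √3) ^ 2 -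
    (-(U 0 1 - U 1 0) / √3) ^ 2 = -1
  simp only [div_pow, h3]
  linear_combination (-4 / 3) * hdet

theorem modelA_quadricCoord {U : Mat2} (htr : U.trace = 1) :
    modelA (quadricCoord U) = 1 - U := by
  have h3 : √3 ≠ (0 : ℝ) := by positivity
  rw [Matrix.trace_fin_two] at htr
  ext i j
  fin_cases i <;> fin_cases j <;> simp [modelA, quadricCoord] <;> field_simp <;> linarith

theorem modelB_quadricCoord {U : Mat2} (htr : U.trace = 1) :
    modelB (quadricCoord U) = U := by
  have h3 : √3 ≠ (0 : ℝ) := by positivity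
  rw [Matrix.trace_fin_two] at htr
  ext i j
  fin_cases i <;> fin_cases j <;> simp [modelB, quadricCoord] <;> field_simp <;> linarith

theorem adjugate_eq_one_sub {U : Mat2} (htr : U.trace = 1) : U.adjugate = 1 - U := by
  rw [Matrix.trace_fin_two] at htr
  rw [Matrix.adjugate_fin_two]
  ext i j
  fin_cases i <;> fin_cases j <;> simp <;> linarith

/-- For trace and determinant one, `U⁻¹ = adj U = 1 - U`, so the explicit immersion is `U ↦ (U⁻¹,
U)` in disguise. -/
theorem model_quadricCoord {U : SL2} (htr : (U : Mat2).trace = 1) :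
    model ⟨quadricCoord U, quadricCoord_mem htr U.det_coe⟩ = (U⁻¹, U) := by
  refine Prod.ext (Subtype.ext ?_) (Subtype.ext ?_)
  · refine (modelA_quadricCoord htr).trans ?_
    rw [← adjugate_eq_one_sub htr]
    exact (Matrix.SpecialLinearGroup.coe_inv U).symm
  · exact modelB_quadricCoord htr

theorem ip_mul_left (U a b : Mat2) : ip (U * a) (U * b) = U.det * ip a b := by
  simp only [ip, Matrix.mul_apply, Fin.sum_univ_two, Matrix.det_fin_two]
  ring

theorem ip_mul_right (U a b : Mat2) : ip (a * U) (b * U) = U.det * ip a b := by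
  simp only [ip, Matrix.mul_apply, Fin.sum_univ_two, Matrix.det_fin_two]
  ring

/-- The adjoint of left multiplication by `U` is left multiplication by `adj U`, and `U + adj U = tr
U`. -/
theorem ip_mul_add_ip_mul (U a b : Mat2) :
    ip (U * a) b + ip a (U * b) = U.trace * ip a b := by
  simp only [ip, Matrix.mul_apply, Fin.sum_univ_two, Matrix.trace_fin_two]
  ring

theorem ip_neg_neg (a b : Mat2) : ip (-a) (-b) = ip a b := by
  simp only [ip, Matrix.neg_apply]
  ring

variable {M : Type*} [TopologicalSpace M] [ChartedSpace (EuclideanSpace ℝ (Fin 2)) M]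

theorem mfderiv_quadricCoord {U : M → Mat2} {p : M} (hU : SmoothMatAt U p)
    (v : TangentSpace (𝓡 2) p) :
    (fun k => mfderiv (𝓡 2) 𝓘(ℝ, ℝ) (fun q => quadricCoord (U q) k) p v) =
      ![-2 / √3 * matDeriv U p v 0 0,
        -1 / √3 * (matDeriv U p v 0 1 + matDeriv U p v 1 0),
        -1 / √3 * (matDeriv U p v 0 1 - matDeriv U p v 1 0)] := by
  have d := fun i j => (hU.mdifferentiableAt i j).hasMFDerivAt
  have c0 : (fun q => quadricCoord (U q) 0) =
      (fun _ => 1 / √3) + (-2 / √3) • (fun q => U q 0 0) := by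
    funext q
    simp [quadricCoord]
    ring
  have c1 : (fun q => quadricCoord (U q) 1) =
      (-1 / √3) • ((fun q => U q 0 1) + (fun q => U q 1 0)) := by
    funext q
    simp [quadricCoord]
    ring
  have c2 : (fun q => quadricCoord (U q) 2) =
      (-1 / √3) • ((fun q => U q 0 1) - (fun q => U q 1 0)) := by
    funext q
    simp [quadricCoord]
    ring
  have d0 := congrArg (fun L => L v)
    ((hasMFDerivAt_const (I := 𝓡 2) (I' := 𝓘(ℝ, ℝ)) (1 / √3 : ℝ) p).add
      ((d 0 0).const_smul (-2 / √3))).mfderiv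
  have d1 := congrArg (fun L => L v) (((d 0 1).add (d 1 0)).const_smul (-1 / √3)).mfderiv
  have d2 := congrArg (fun L => L v) (((d 0 1).sub (d 1 0)).const_smul (-1 / √3)).mfderiv
  funext k
  fin_cases k
  · refine (congrArg (fun f => mfderiv (𝓡 2) 𝓘(ℝ, ℝ) f p v) c0).trans (d0.trans ?_)
    exact zero_add _
  · exact (congrArg (fun f => mfderiv (𝓡 2) 𝓘(ℝ, ℝ) f p v) c1).trans d1
  · exact (congrArg (fun f => mfderiv (𝓡 2) 𝓘(ℝ, ℝ) f p v) c2).trans d2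

theorem contMDiff_quadricCoord {U : M → Mat2} (hU : ∀ p, SmoothMatAt U p) (k : Fin 3) :
    ContMDiff (𝓡 2) 𝓘(ℝ, ℝ) ∞ (fun q => quadricCoord (U q) k) := by
  have d : ∀ i j, ContMDiff (𝓡 2) 𝓘(ℝ, ℝ) ∞ (fun q => U q i j) := fun i j q => hU q i j
  fin_cases k
  · exact (contMDiff_const.sub (contMDiff_const.mul (d 0 0))).div_const _
  · exact ((d 0 1).add (d 1 0)).neg.div_const _
  · exact ((d 0 1).sub (d 1 0)).neg.div_const _

/-- On trace-free matrices `-det` is a Lorentz form, and `U - 1/2` is `-√3/2` times the trace-free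
matrix with coordinates `y`; the square of this factor is the `3/4`. -/
theorem lorentz_mfderiv_quadricCoord {U : M → Mat2} {p : M} (hU : SmoothMatAt U p)
    (v w : TangentSpace (𝓡 2) p) (hv : (matDeriv U p v).trace = 0)
    (hw : (matDeriv U p w).trace = 0) :
    3 / 4 * lorentz (fun k => mfderiv (𝓡 2) 𝓘(ℝ, ℝ) (fun q => quadricCoord (U q) k) p v)
      (fun k => mfderiv (𝓡 2) 𝓘(ℝ, ℝ) (fun q => quadricCoord (U q) k) p w) =
      ip (matDeriv U p v) (matDeriv U p w) := by
  have h3 : √3 ^ 2 = (3 : ℝ) := Real.sq_sqrt (by norm_num)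
  have h3' : √3 ≠ (0 : ℝ) := by positivity
  rw [mfderiv_quadricCoord hU, mfderiv_quadricCoord hU]
  rw [Matrix.trace_fin_two] at hv hw
  generalize matDeriv U p v = X at *
  generalize matDeriv U p w = Y at *
  have hX : X 1 1 = -X 0 0 := by linarith
  have hY : Y 1 1 = -Y 0 0 := by linarith
  simp only [lorentz, ip, hX, hY, Matrix.cons_val]
  field_simp
  rw [h3]
  ring

/-- With `β = Uα`, `det U = tr U = 1`, the metric reduces to `(4/3 - 1/3)⟨α,α'⟩`, and `dU = -αU` has
the same inner products as `α`. -/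
theorem inducedMetric_eq_lorentz [IsManifold (𝓡 2) ∞ M] {F : M → Amb} {U : M → SL2}
    (hF : IsAlmostComplexSurface F)
    (hgeo : IsTotallyGeodesic F) (hP : PMapsTangentToNormal F)
    (htr : ∀ p, (U p : Mat2).trace = 1)
    (hU : ∀ p, ∀ v, (leftDiff F p v).2 = (U p : Mat2) * (leftDiff F p v).1) (p : M)
    (v w : TangentSpace (𝓡 2) p) :
    inducedMetric F p v w = 3 / 4 *
      lorentz (fun k => mfderiv (𝓡 2) 𝓘(ℝ, ℝ) (fun q => quadricCoord (U q) k) p v)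
        (fun k => mfderiv (𝓡 2) 𝓘(ℝ, ℝ) (fun q => quadricCoord (U q) k) p w) := by
  have htrace : ∀ v, (matDeriv (fun q => (U q : Mat2)) p v).trace = 0 := by
    intro v
    have ha := hF.smooth.trace_leftDiff_fst p v
    have hb := hF.smooth.trace_leftDiff_snd p v
    rw [hU, Matrix.trace_mul_comm] at hb
    rw [hF.matDeriv_rotation hgeo hP htr hU, Matrix.trace_neg, hb, neg_zero]
  rw [lorentz_mfderiv_quadricCoord (hF.smooth_rotation hP hU p) v w (htrace v) (htrace w),
    hF.matDeriv_rotation hgeo hP htr hU, hF.matDeriv_rotation hgeo hP htr hU, ip_neg_neg,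
    ip_mul_right, (U p).det_coe, inducedMetric_eq, hU, hU, ip_mul_left, (U p).det_coe,
    ip_mul_add_ip_mul, htr]
  ring

/-! ### Transfer to charts -/

theorem mfderiv_comp_chart_symm [IsManifold (𝓡 2) ∞ M] {e : OpenPartialHomeomorph M Plane}
    (he : e ∈ IsManifold.maximalAtlas (𝓡 2) ∞ M) {z : Plane} (hz : z ∈ e.target) {f : M → ℝ}
    (hf : MDifferentiableAt (𝓡 2) 𝓘(ℝ, ℝ) f (e.symm z)) (u : TangentSpace (𝓡 2) z) :
    mfderiv (𝓡 2) 𝓘(ℝ, ℝ) (fun w => f (e.symm w)) z u =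
      mfderiv (𝓡 2) 𝓘(ℝ, ℝ) f (e.symm z) (mfderiv (𝓡 2) (𝓡 2) e.symm z u) := by
  have hs : MDifferentiableAt (𝓡 2) (𝓡 2) e.symm z :=
    ((contMDiffOn_symm_of_mem_maximalAtlas he).contMDiffAt
      (e.open_target.mem_nhds hz)).mdifferentiableAt (by simp)
  exact congrArg (fun L => L u) (HasMFDerivAt.comp z hf.hasMFDerivAt hs.hasMFDerivAt).mfderiv

theorem inducedMetric_comp_chart_symm [IsManifold (𝓡 2) ∞ M] {F : M → Amb} (hF : IsSmooth F)
    {e : OpenPartialHomeomorph M Plane}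
    (he : e ∈ IsManifold.maximalAtlas (𝓡 2) ∞ M) {z : Plane} (hz : z ∈ e.target)
    (u w : TangentSpace (𝓡 2) z) :
    inducedMetric (fun x => F (e.symm x)) z u w =
      inducedMetric F (e.symm z) (mfderiv (𝓡 2) (𝓡 2) e.symm z u)
        (mfderiv (𝓡 2) (𝓡 2) e.symm z w) := by
  have h : ∀ u, differential (fun x => F (e.symm x)) z u =
      differential F (e.symm z) (mfderiv (𝓡 2) (𝓡 2) e.symm z u) := by
    intro u
    ext i j
    · exact mfderiv_comp_chart_symm he hz ((hF.fst _).mdifferentiableAt i j) u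
    · exact mfderiv_comp_chart_symm he hz ((hF.snd _).mdifferentiableAt i j) u
  simp only [inducedMetric, h]

theorem mfderiv_chart_symm_injective [IsManifold (𝓡 2) ∞ M] {e : OpenPartialHomeomorph M Plane}
    (he : e ∈ IsManifold.maximalAtlas (𝓡 2) ∞ M) {z : Plane} (hz : z ∈ e.target) :
    Function.Injective (mfderiv (𝓡 2) (𝓡 2) e.symm z) := by
  have hd : e.MDifferentiable (𝓡 2) (𝓡 2) :=
    ⟨(contMDiffOn_of_mem_maximalAtlas he).mdifferentiableOn (by simp),
      (contMDiffOn_symm_of_mem_maximalAtlas he).mdifferentiableOn (by simp)⟩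
  exact hd.symm.mfderiv_injective hz

theorem inducedMetric_comm (F : M → Amb) (p : M) (v w : TangentSpace (𝓡 2) p) :
    inducedMetric F p v w = inducedMetric F p w v := by
  simp only [inducedMetric_eq, ip]
  ring

/-- The coefficient matrix of the induced metric in a chart is invertible. -/
theorem det_coeffMatrix_ne_zero [IsManifold (𝓡 2) ∞ M] {F : M → Amb}
    (hF : IsAlmostComplexSurface F) {e : OpenPartialHomeomorph M Plane}
    (he : e ∈ IsManifold.maximalAtlas (𝓡 2) ∞ M) {z : Plane} (hz : z ∈ e.target) :
    (coeffMatrix (fun z => F (e.symm z)) z).det ≠ 0 := by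
  intro h0
  obtain ⟨c, hc, hmul⟩ := Matrix.exists_mulVec_eq_zero_iff.2 h0
  set u : Fin 2 → TangentSpace (𝓡 2) (e.symm z) := fun i =>
    mfderiv (𝓡 2) (𝓡 2) e.symm z (EuclideanSpace.single i (1 : ℝ) : Plane) with hu
  have hcoef : ∀ i j, coeffMatrix (fun z => F (e.symm z)) z i j =
      inducedMetric F (e.symm z) (u i) (u j) :=
    fun i j => inducedMetric_comp_chart_symm hF.smooth he hz _ _
  set x : TangentSpace (𝓡 2) z := (WithLp.toLp 2 c : Plane) with hx
  have hxsum : ∀ d : Fin 2 → ℝ, (WithLp.toLp 2 d : Plane) =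
      d 0 • (EuclideanSpace.single 0 (1 : ℝ) : Plane) +
        d 1 • (EuclideanSpace.single 1 (1 : ℝ) : Plane) := by
    intro d
    ext i
    fin_cases i <;> simp
  have hmx : mfderiv (𝓡 2) (𝓡 2) e.symm z x = c 0 • u 0 + c 1 • u 1 := by
    rw [hx]
    refine (congrArg (mfderiv (𝓡 2) (𝓡 2) e.symm z) (hxsum c)).trans ?_
    exact (map_add _ _ _).trans (congrArg₂ _ (map_smul _ _ _) (map_smul _ _ _))
  -- A kernel vector of the coefficient matrix is carried to a vector orthogonal to the whole
  -- tangent plane, which regularity forces to vanish.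
  have hmx0 : mfderiv (𝓡 2) (𝓡 2) e.symm z x = 0 := by
    apply hF.regular
    intro w
    have hw : ∃ s t : ℝ, w = s • u 0 + t • u 1 := by
      have hsurj : Function.Surjective (mfderiv (𝓡 2) (𝓡 2) e.symm z) := by
        have hd : e.MDifferentiable (𝓡 2) (𝓡 2) :=
          ⟨(contMDiffOn_of_mem_maximalAtlas he).mdifferentiableOn (by simp),
            (contMDiffOn_symm_of_mem_maximalAtlas he).mdifferentiableOn (by simp)⟩
        exact hd.symm.mfderiv_surjective hz
      obtain ⟨d, rfl⟩ := hsurj w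
      refine ⟨(show Plane from d) 0, (show Plane from d) 1, ?_⟩
      refine (congrArg (mfderiv (𝓡 2) (𝓡 2) e.symm z)
        (hxsum (fun i => (show Plane from d) i))).trans ?_
      exact (map_add _ _ _).trans (congrArg₂ _ (map_smul _ _ _) (map_smul _ _ _))
    obtain ⟨s, t, rfl⟩ := hw
    have m0 := congrFun hmul 0
    have m1 := congrFun hmul 1
    simp only [Matrix.mulVec, dotProduct, Fin.sum_univ_two, hcoef, Pi.zero_apply] at m0 m1
    rw [hmx, inducedMetric_add_right, inducedMetric_smul_right, inducedMetric_smul_right,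
      inducedMetric_comm F _ _ (u 0), inducedMetric_comm F _ _ (u 1)]
    simp only [inducedMetric_add_right, inducedMetric_smul_right]
    linear_combination s * m0 + t * m1
  have hx0 : x = 0 := mfderiv_chart_symm_injective he hz (hmx0.trans (map_zero _).symm)
  apply hc
  funext i
  exact congrFun (congrArg (fun q : Plane => (q : Fin 2 → ℝ)) hx0) i

end Congruence

end NKSL

/-! ### Congruence with the explicit immersion, and the curvature -/

theorem proposition4p5 {M : Type*} [TopologicalSpace M]
    [ChartedSpace (EuclideanSpace ℝ (Fin 2)) M] [IsManifold (𝓡 2) ∞ M] [ConnectedSpace M]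
    (F : M → NKSL.Amb) (hF : NKSL.IsAlmostComplexSurface F)
    (hgeo : NKSL.IsTotallyGeodesic F) (hP : NKSL.PMapsTangentToNormal F) :
    (∃ (a b c : NKSL.SL2) (y : M → NKSL.Quadric),
      ContMDiff (𝓡 2) 𝓘(ℝ, Fin 3 → ℝ) ∞ (fun p => (y p : Fin 3 → ℝ)) ∧
      (∀ p, Function.Injective
        (mfderiv (𝓡 2) 𝓘(ℝ, Fin 3 → ℝ) (fun q => (y q : Fin 3 → ℝ)) p)) ∧
      ∀ p, F p = NKSL.congruence a b c (NKSL.model (y p))) ∧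
    NKSL.HasGaussCurvature F (-4 / 3) := by
  obtain ⟨U, hUboth⟩ := hF.exists_rotation hP
  have htr := fun p => (hUboth p).1
  have hU := fun p => (hUboth p).2
  have hsm := hF.smooth_rotation hP hU
  have hycoord := NKSL.contMDiff_quadricCoord hsm
  have hy : ContMDiff (𝓡 2) 𝓘(ℝ, Fin 3 → ℝ) ∞
      (fun p => NKSL.quadricCoord (U p : NKSL.Mat2)) := contMDiff_pi_space.2 hycoord
  have hmetric := NKSL.inducedMetric_eq_lorentz hF hgeo hP htr hU
  constructor
  · obtain ⟨p₀⟩ : Nonempty M := inferInstance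
    -- The constants are the values of `AU` and `BU⁻¹` at a base point.
    refine ⟨(F p₀).1 * U p₀, (F p₀).2 * (U p₀)⁻¹, 1,
      fun p => ⟨NKSL.quadricCoord (U p), NKSL.quadricCoord_mem (htr p) (U p).det_coe⟩,
      hy, ?_, ?_⟩
    · intro p
      -- The induced metric is a multiple of the Lorentz product of differentials of `y`, so `dy(v)
      -- = 0` puts `v` in its radical.
      refine (injective_iff_map_eq_zero _).2 fun v hv => hF.regular p v fun w => ?_
      have hcomp : ∀ k, mfderiv (𝓡 2) 𝓘(ℝ, ℝ)
          (fun q => NKSL.quadricCoord (U q : NKSL.Mat2) k) p v = 0 := by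
        intro k
        have h1 := (hy p).mdifferentiableAt (by simp)
        have h2 := ((ContinuousLinearMap.proj (R := ℝ) (φ := fun _ : Fin 3 => ℝ)
          k).hasMFDerivAt.comp p h1.hasMFDerivAt).mfderiv
        refine (congrArg (fun L => L v) h2).trans ?_
        exact congrFun hv k
      have hzero : (fun k => mfderiv (𝓡 2) 𝓘(ℝ, ℝ)
          (fun q => NKSL.quadricCoord (U q : NKSL.Mat2) k) p v : Fin 3 → ℝ) = 0 := funext hcomp
      rw [hmetric, hzero]
      exact mul_eq_zero_of_right _ (NKSL.lorentz_zero_left _)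
    · intro p
      have h1 : (F p).1 * U p = (F p₀).1 * U p₀ := by
        refine Subtype.ext ?_
        exact NKSL.eq_of_matDeriv_eq_zero (fun q => (hF.smooth.fst q).mul (hsm q))
          (hF.matDeriv_fst_mul_rotation hgeo hP htr hU) p p₀
      have h2 : (F p).2 * (U p)⁻¹ = (F p₀).2 * (U p₀)⁻¹ := by
        refine Subtype.ext ?_
        have h := NKSL.eq_of_matDeriv_eq_zero
          (fun q => (hF.smooth.snd q).mul ((NKSL.smoothMatAt_const 1 q).sub (hsm q)))
          (hF.matDeriv_snd_mul_rotation_inv hgeo hP htr hU) p p₀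
        simpa only [Matrix.SpecialLinearGroup.coe_mul, Matrix.SpecialLinearGroup.coe_inv,
          NKSL.adjugate_eq_one_sub (htr _)] using h
      rw [NKSL.model_quadricCoord (htr p), NKSL.congruence, ← h1, ← h2]
      simp
  · intro e he x hx
    have hsymm := contMDiffOn_symm_of_mem_maximalAtlas he
    -- The factor `3/4` relates the induced metric to the Lorentz form, and `-1 / (3/4) = -4/3`.
    have h := NKSL.gaussCurvature_of_quadric (c := 3 / 4) (O := e.target)
      (y := fun k z => NKSL.quadricCoord (U (e.symm z) : NKSL.Mat2) k)
      (h := NKSL.coeffMatrix (fun z => F (e.symm z))) (by norm_num) e.open_target ?_ ?_ ?_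
      (fun z hz => NKSL.det_coeffMatrix_ne_zero hF he hz) hx
    · rw [h]
      norm_num
    · intro k
      exact contMDiffOn_iff_contDiffOn.1 ((hycoord k).comp_contMDiffOn hsymm)
    · intro z _
      have hq : NKSL.quadricCoord (U (e.symm z) : NKSL.Mat2) ∈ NKSL.Quadric :=
        NKSL.quadricCoord_mem (htr _) (U (e.symm z)).det_coe
      simp only [NKSL.lorentz, ← sq]
      exact hq
    · intro z hz i j
      have hpd : ∀ i k, NKSL.pd i (fun z => NKSL.quadricCoord (U (e.symm z) : NKSL.Mat2) k) z =
          mfderiv (𝓡 2) 𝓘(ℝ, ℝ) (fun q => NKSL.quadricCoord (U q : NKSL.Mat2) k) (e.symm z)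
            (mfderiv (𝓡 2) (𝓡 2) e.symm z (EuclideanSpace.single i (1 : ℝ) : NKSL.Plane)) := by
        intro i k
        rw [NKSL.pd, ← mfderiv_eq_fderiv]
        exact NKSL.mfderiv_comp_chart_symm he hz
          ((hycoord k _).mdifferentiableAt (by simp)) _
      simp only [hpd]
      exact (NKSL.inducedMetric_comp_chart_symm hF.smooth he hz _ _).trans (hmetric _ _ _)
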